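/- **Conventions.** Fix a field $F$ and a degree $k\ge 0$. For a finite set $S$ with a dissimilarity $d:S\times S\to\mathbb{R}_{\ge 0}$ (so $d(x,x)=0$), let $\mathrm{dgm}(S,d)$ be the persistence diagram of the $k$-th homology, with coefficients in $F$, of the Vietoris–Rips filtration $S_r=\{(x_0,\dots,x_m)\mid d(x_i,x_j)\le r \text{ for all } i,j\}$: the multiset of birth–death pairs $(b,e)$, $0\le b<e\le\infty$, together with the diagonal $\Delta$ with infinite multiplicity. A matching $\Omega$ of two diagrams is a set of pairs of points in which every off-diagonal point of either diagram appears exactly once and in which no two diagonal points are paired; $d_B$ is the infimum, over all matchings, of $\sup_{(p,q)\in\Omega}\|p-q\|_\infty$. **Theorem.** Let $(X,d_X)$ be a non-empty finite dissimilarity space and let $Y=(y_j)_{j\in J}$ be a finite family of points in a real normed space $E$ whose norm is differentiable away from $0$ (for example Euclidean space), with $d_Y(y_i,y_j)=\|y_i-y_j\|$. Suppose that $d_B(\mathrm{dgm}(Y),\mathrm{dgm}(X))>0$, and that a single pair in $\mathrm{dgm}(Y)$ realizes the bottleneck distance: there are an optimal matching $\Omega$ and an off-diagonal point $p=(b,e)$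 of $\mathrm{dgm}(Y)$, matched in $\Omega$ with a point $q$ of $\mathrm{dgm}(X)$ (possibly a diagonal point), such that $(p,q)$ is the only pair of $\Omega$ with $\|p-q\|_\infty=d_B(\mathrm{dgm}(Y),\mathrm{dgm}(X))$. Suppose moreover that each of the filtration values $b$ (if $b>0$) and $e$ is attained as a distance $d_Y(y_i,y_j)$ by at most one unordered pair of indices $\{i,j\}$. Then the function $Z\mapsto d_B(\mathrm{dgm}(Z),\mathrm{dgm}(X))$ of the point positions $Z\in E^J$ admits a descent direction at $Y$: its value at $Y$ is finite and there are $v\in E^J$ and $c>0$ such that, for all sufficiently small $t>0$, $$d_B(\mathrm{dgm}(Y+tv),\mathrm{dgm}(X))\le d_B(\mathrm{dgm}(Y),\mathrm{dgm}(X))-ct .$$ -/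

import Mathlib

open Filter Topology
open scoped ENNReal

universe u v w

/-! ### Persistence vector spaces -/

/-- A persistence vector space over the field `F`, indexed by the real line. -/
structure PersistenceVectorSpace (F : Type u) [Field F] where
  space : ℝ → Type v
  [addCommGroup : ∀ r, AddCommGroup (space r)]
  [module : ∀ r, Module F (space r)]
  map : ∀ {r s : ℝ}, r ≤ s → space r →ₗ[F] space s
  map_refl : ∀ (r : ℝ) (x : space r), map (le_refl r) x = x
  map_map : ∀ {r s t : ℝ} (hrs : r ≤ s) (hst : s ≤ t) (x : space r),
    map hst (map hrs x) = map (hrs.trans hst) x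

attribute [instance] PersistenceVectorSpace.addCommGroup PersistenceVectorSpace.module

namespace PersistenceVectorSpace

variable {F : Type u} [Field F]

/-- The vectors at parameter `b` which come from some earlier parameter. -/
def olderThan (V : PersistenceVectorSpace.{u, v} F) (b : ℝ) : Submodule F (V.space b) :=
  ⨆ (s : ℝ) (h : s < b), LinearMap.range (V.map h.le)

/-- The vectors at parameter `b` which vanish at parameter `d`. For real `d ≥ b` this is the kernel
of `V_b → V_d`; for `d = ⊤` it is the whole space. -/
def deadAt (V : PersistenceVectorSpace.{u, v} F) (b : ℝ) (d : WithTop ℝ) :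
    Submodule F (V.space b) :=
  ⨅ (t : ℝ) (h : b ≤ t) (_ : d ≤ (t : WithTop ℝ)), LinearMap.ker (V.map h)

/-- The vectors at parameter `b` which vanish at some parameter before `d`. -/
def deadBefore (V : PersistenceVectorSpace.{u, v} F) (b : ℝ) (d : WithTop ℝ) :
    Submodule F (V.space b) :=
  ⨆ (t : ℝ) (h : b ≤ t) (_ : (t : WithTop ℝ) < d), LinearMap.ker (V.map h)

/-- The multiplicity of the birth-death pair `(b, d)`, i.e. of the interval `[b, d)`: the dimension
of the space of vectors at `b` that vanish at `d`, modulo those that are older than `b` and those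
that vanish before `d`. -/
noncomputable def multiplicity (V : PersistenceVectorSpace.{u, v} F) (b : ℝ) (d : WithTop ℝ) : ℕ :=
  Module.finrank F
    (V.deadAt b d ⧸ ((V.olderThan b ⊓ V.deadAt b d) ⊔ V.deadBefore b d).submoduleOf (V.deadAt b d))

end PersistenceVectorSpace

/-! ### Persistence diagrams and the bottleneck distance -/

/-- The off-diagonal part of a persistence diagram, as a multiplicity function on birth-death
pairs; classes which never die have death `⊤`. The diagonal is added in `DiagramPoint`. -/
abbrev PersistenceDiagram : Type := ℝ × WithTop ℝ → ℕ

open Classical in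
/-- The persistence diagram of a persistence vector space. -/
noncomputable def PersistenceVectorSpace.dgm {F : Type u} [Field F]
    (V : PersistenceVectorSpace.{u, v} F) : PersistenceDiagram :=
  fun p => if (p.1 : WithTop ℝ) < p.2 then V.multiplicity p.1 p.2 else 0

/-- The off-diagonal points of a diagram, a point of multiplicity `m` being listed `m` times. -/
abbrev OffDiagonalPoint (D : PersistenceDiagram) : Type :=
  Σ p : ℝ × WithTop ℝ, Fin (D p)

/-- The points of a diagram: the off-diagonal ones, and the diagonal points `(x, x)`. A matching may
use a diagonal point any number of times, so it is not necessary to list copies of it. -/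
abbrev DiagramPoint (D : PersistenceDiagram) : Type :=
  OffDiagonalPoint D ⊕ ℝ

/-- The coordinates of a point of a diagram. -/
def DiagramPoint.coords {D : PersistenceDiagram} : DiagramPoint D → ℝ × WithTop ℝ
  | Sum.inl a => a.1
  | Sum.inr x => (x, (x : WithTop ℝ))

/-- The distance of two death times in `ℝ ∪ {∞}`. -/
noncomputable def deathDist : WithTop ℝ → WithTop ℝ → ℝ≥0∞
  | some s, some t => ENNReal.ofReal |s - t|
  | none, none => 0
  | _, _ => ⊤

/-- The `ℓ^∞`-distance of two birth-death pairs. -/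
noncomputable def pairDist (p q : ℝ × WithTop ℝ) : ℝ≥0∞ :=
  max (ENNReal.ofReal |p.1 - q.1|) (deathDist p.2 q.2)

/-- The cost of matching two points of two diagrams. -/
noncomputable def matchCost {D₁ D₂ : PersistenceDiagram}
    (m : DiagramPoint D₁ × DiagramPoint D₂) : ℝ≥0∞ :=
  pairDist m.1.coords m.2.coords

/-- Matchings of two diagrams: every off-diagonal point appears exactly once. Pairs of two diagonal
points are not considered. -/
structure IsMatching {D₁ D₂ : PersistenceDiagram}
    (Ω : Set (DiagramPoint D₁ × DiagramPoint D₂)) : Prop where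
  left : ∀ a : OffDiagonalPoint D₁, ∃! q : DiagramPoint D₂, (Sum.inl a, q) ∈ Ω
  right : ∀ a : OffDiagonalPoint D₂, ∃! p : DiagramPoint D₁, (p, Sum.inl a) ∈ Ω
  not_diagonal : ∀ x y : ℝ, (Sum.inr x, Sum.inr y) ∉ Ω

/-- The cost of a matching: the largest cost of its pairs. -/
noncomputable def matchingCost {D₁ D₂ : PersistenceDiagram}
    (Ω : Set (DiagramPoint D₁ × DiagramPoint D₂)) : ℝ≥0∞ :=
  ⨆ m ∈ Ω, matchCost m

/-- The bottleneck distance of two diagrams. -/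
noncomputable def bottleneckDist (D₁ D₂ : PersistenceDiagram) : ℝ≥0∞ :=
  ⨅ (Ω : Set (DiagramPoint D₁ × DiagramPoint D₂)) (_ : IsMatching Ω), matchingCost Ω

/-- The point `a` of `D₁`, matched with `q`, is the single pair that realizes the bottleneck
distance, in some optimal matching. -/
def RealizesBottleneck {D₁ D₂ : PersistenceDiagram}
    (a : OffDiagonalPoint D₁) (q : DiagramPoint D₂) : Prop :=
  ∃ Ω : Set (DiagramPoint D₁ × DiagramPoint D₂),
    IsMatching Ω ∧ matchingCost Ω = bottleneckDist D₁ D₂ ∧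
    (Sum.inl a, q) ∈ Ω ∧
    ∀ m ∈ Ω, matchCost m = bottleneckDist D₁ D₂ ↔ m = (Sum.inl a, q)

/-! ### Vietoris-Rips persistent homology -/

/-- The quotient of `Z` by (its intersection with) `B`. -/
def Subquotient {F : Type u} [Field F] {A : Type w} [AddCommGroup A] [Module F A]
    (Z B : Submodule F A) : Type w :=
  Z ⧸ B.submoduleOf Z

instance {F : Type u} [Field F] {A : Type w} [AddCommGroup A] [Module F A]
    (Z B : Submodule F A) : AddCommGroup (Subquotient Z B) :=
  inferInstanceAs (AddCommGroup (Z ⧸ B.submoduleOf Z))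

instance {F : Type u} [Field F] {A : Type w} [AddCommGroup A] [Module F A]
    (Z B : Submodule F A) : Module F (Subquotient Z B) :=
  inferInstanceAs (Module F (Z ⧸ B.submoduleOf Z))

/-- The map of quotients induced by inclusions. -/
def Subquotient.map {F : Type u} [Field F] {A : Type w} [AddCommGroup A] [Module F A]
    {Z B Z' B' : Submodule F A} (hZ : Z ≤ Z') (hB : B ≤ B') :
    Subquotient Z B →ₗ[F] Subquotient Z' B' :=
  Submodule.mapQ (B.submoduleOf Z) (B'.submoduleOf Z') (Submodule.inclusion hZ) fun _ hx => hB hx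

theorem Subquotient.map_refl {F : Type u} [Field F] {A : Type w} [AddCommGroup A] [Module F A]
    {Z B : Submodule F A} (x : Subquotient Z B) :
    Subquotient.map (le_refl Z) (le_refl B) x = x :=
  Submodule.Quotient.induction_on (B.submoduleOf Z) x fun _ => rfl

theorem Subquotient.map_map {F : Type u} [Field F] {A : Type w} [AddCommGroup A] [Module F A]
    {Z B Z' B' Z'' B'' : Submodule F A} (hZ : Z ≤ Z') (hB : B ≤ B') (hZ' : Z' ≤ Z'')
    (hB' : B' ≤ B'') (x : Subquotient Z B) :
    Subquotient.map hZ' hB' (Subquotient.map hZ hB x) =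
      Subquotient.map (hZ.trans hZ') (hB.trans hB') x :=
  Submodule.Quotient.induction_on (B.submoduleOf Z) x fun _ => rfl

namespace VietorisRips

variable (F : Type u) [Field F] {ι : Type w}

/-- The `k`-simplices of the Vietoris-Rips complex at scale `r`, as tuples of vertices. -/
def simplices (d : ι → ι → ℝ) (k : ℕ) (r : ℝ) : Set (Fin (k + 1) → ι) :=
  {x | ∀ i j, d (x i) (x j) ≤ r}

/-- The boundary of ordered chains, from degree `k + 1` to degree `k`: a tuple goes to the
alternating sum of its faces. -/
noncomputable def boundary (ι : Type w) (k : ℕ) :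
    ((Fin (k + 2) → ι) →₀ F) →ₗ[F] ((Fin (k + 1) → ι) →₀ F) :=
  Finsupp.lsum F fun x => ∑ i : Fin (k + 2),
    ((-1 : F) ^ (i : ℕ)) • Finsupp.lsingle (fun j : Fin (k + 1) => x (i.succAbove j))

/-- The chains of degree `k` at scale `r`: the span of the `k`-simplices at scale `r`. -/
noncomputable def chains (d : ι → ι → ℝ) (k : ℕ) (r : ℝ) : Submodule F ((Fin (k + 1) → ι) →₀ F) :=
  Finsupp.supported F F (simplices d k r)

/-- The cycles of degree `k` at scale `r`; the boundary vanishes on chains of degree `0`. -/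
noncomputable def cycles (d : ι → ι → ℝ) : (k : ℕ) → ℝ → Submodule F ((Fin (k + 1) → ι) →₀ F)
  | 0, r => chains F d 0 r
  | k + 1, r => chains F d (k + 1) r ⊓ LinearMap.ker (boundary F ι k)

/-- The boundaries of degree `k` at scale `r`. -/
noncomputable def boundaries (d : ι → ι → ℝ) (k : ℕ) (r : ℝ) :
    Submodule F ((Fin (k + 1) → ι) →₀ F) :=
  (chains F d (k + 1) r).map (boundary F ι k)

/-- The homology in degree `k` at scale `r`: cycles modulo boundaries. -/
abbrev Homology (d : ι → ι → ℝ) (k : ℕ) (r : ℝ) : Type (max u w) :=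
  Subquotient (cycles F d k r) (boundaries F d k r)

theorem chains_mono (d : ι → ι → ℝ) (k : ℕ) {r s : ℝ} (h : r ≤ s) :
    chains F d k r ≤ chains F d k s :=
  Finsupp.supported_mono fun _ hx i j => (hx i j).trans h

theorem cycles_mono (d : ι → ι → ℝ) (k : ℕ) {r s : ℝ} (h : r ≤ s) :
    cycles F d k r ≤ cycles F d k s := by
  cases k with
  | zero => exact chains_mono F d 0 h
  | succ k => exact inf_le_inf_right _ (chains_mono F d (k + 1) h)

theorem boundaries_mono (d : ι → ι → ℝ) (k : ℕ) {r s : ℝ} (h : r ≤ s) :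
    boundaries F d k r ≤ boundaries F d k s :=
  Submodule.map_mono (chains_mono F d (k + 1) h)

/-- The map induced in homology by the inclusion of the complex at scale `r` in that at scale
`s`. -/
noncomputable def homologyMap (d : ι → ι → ℝ) (k : ℕ) {r s : ℝ} (h : r ≤ s) :
    Homology F d k r →ₗ[F] Homology F d k s :=
  Subquotient.map (cycles_mono F d k h) (boundaries_mono F d k h)

/-- The `k`-th persistent homology of the Vietoris-Rips filtration of `(ι, d)`. -/
noncomputable def persistentHomology (d : ι → ι → ℝ) (k : ℕ) :
    PersistenceVectorSpace.{u, max u w} F where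
  space := Homology F d k
  map := homologyMap F d k
  map_refl _ x := Subquotient.map_refl x
  map_map _ _ x := Subquotient.map_map _ _ _ _ x

/-- The diagram of the `k`-th persistent homology of the Vietoris-Rips filtration. -/
noncomputable def dgm (d : ι → ι → ℝ) (k : ℕ) : PersistenceDiagram :=
  (persistentHomology F d k).dgm

end VietorisRips

/-- The dissimilarity of a point cloud in a metric space. -/
def cloudDist {κ : Type w} {E : Type v} [Dist E] (Y : κ → E) : κ → κ → ℝ :=
  fun i j => dist (Y i) (Y j)

/-! ### Descent directions -/

/-- `v` is a descent direction at `y` of a function which is finite at `y`: along the ray from `y`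
in direction `v` the function decreases at least at some positive linear rate `c`. -/
def IsDescentDirection {M : Type w} [AddCommGroup M] [Module ℝ M] (f : M → ℝ≥0∞) (y v : M) : Prop :=
  f y ≠ ⊤ ∧ ∃ c : ℝ, 0 < c ∧ ∀ᶠ t : ℝ in 𝓝[>] 0, f (y + t • v) + ENNReal.ofReal (c * t) ≤ f y

/-! Write `D` for the bottleneck distance and `(p, q)` for the pair realizing it. Every other pair
of the optimal matching costs at most `D - η` for some `η > 0`, because a matching of finite
diagrams is finite (`RealizesBottleneck.exists_margin`). It therefore suffices to perturb `Y` so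
that `p` approaches `q` at a linear rate while the rest of the diagram moves by less than about `η /
2`.

Local stability (`VietorisRips.exists_injective_dgm`): the number of diagram points in a box is an
alternating sum of the ranks of the structure maps at its corners
(`IsCriticalSet.sum_multiplicity`), and these ranks depend only on which distances lie below the
corner values. If the distances move by at most `δ`, much less than the gaps between distinct
distances, the complexes at levels `2δ` below or above an old distance do not change. Hence each old
point is followed by exactly as many new points nearby, and all remaining new points are near the
diagonal. The optimal matching is carried along this injection, the remaining points being sent to
the diagonal (`bottleneckDist_le_of_injective`).

Moving `p = (b, e)`: its coordinates are distances. By uniqueness, `e` and, if positive, `b` belong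
to single, different pairs of indices. Each of these pairs has an endpoint outside the other pair;
pushing it along the line through its partner makes the two distances exactly affine in `t`, with
arbitrary prescribed rates (`exists_direction`). Rates that bring `p` closer to `q` come from
`exists_rates`. A birth `b = 0` cannot be moved, but it need not be: it occurs only in degree 0,
where every birth in `dgm X` is 0 too.

Infinite deaths cause no trouble: a non-empty space has exactly one essential class, born at 0, in
degree 0 and none in higher degrees. So `D` is finite, and `p` is not essential since its cost would
then be 0. -/

/-! ### Ranks of the structure maps and critical parameters -/

namespace PersistenceVectorSpace

variable {F : Type u} [Field F]

/-- The rank of the map from parameter `s` to parameter `t`. -/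
noncomputable def rank (V : PersistenceVectorSpace.{u, v} F) (s t : ℝ) : ℕ :=
  if h : s ≤ t then Module.finrank F (LinearMap.range (V.map h)) else 0

theorem rank_of_le (V : PersistenceVectorSpace.{u, v} F) {s t : ℝ} (h : s ≤ t) :
    V.rank s t = Module.finrank F (LinearMap.range (V.map h)) :=
  dif_pos h

/-- The vector space changes only at the parameters in `C`. -/
def IsCriticalSet (V : PersistenceVectorSpace.{u, v} F) (C : Finset ℝ) : Prop :=
  ∀ ⦃s t : ℝ⦄ (h : s ≤ t), (∀ c ∈ C, ¬(s < c ∧ c ≤ t)) → Function.Bijective (V.map h)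

theorem map_comp (V : PersistenceVectorSpace.{u, v} F) {r s t : ℝ} (hrs : r ≤ s) (hst : s ≤ t) :
    (V.map hst).comp (V.map hrs) = V.map (hrs.trans hst) :=
  LinearMap.ext fun x => V.map_map hrs hst x

theorem range_map_mono (V : PersistenceVectorSpace.{u, v} F) {r s t : ℝ} (hrs : r ≤ s)
    (hst : s ≤ t) : LinearMap.range (V.map (hrs.trans hst)) ≤ LinearMap.range (V.map hst) := by
  rw [← V.map_comp hrs hst]
  exact LinearMap.range_comp_le_range _ _

theorem ker_map_mono (V : PersistenceVectorSpace.{u, v} F) {r s t : ℝ} (hrs : r ≤ s)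
    (hst : s ≤ t) : LinearMap.ker (V.map hrs) ≤ LinearMap.ker (V.map (hrs.trans hst)) := by
  rw [← V.map_comp hrs hst]
  exact LinearMap.ker_le_ker_comp _ _

theorem range_map_eq (V : PersistenceVectorSpace.{u, v} F) {r s t : ℝ} (hrs : r ≤ s)
    (hst : s ≤ t) (h : Function.Surjective (V.map hrs)) :
    LinearMap.range (V.map (hrs.trans hst)) = LinearMap.range (V.map hst) := by
  rw [← V.map_comp hrs hst, LinearMap.range_comp_of_range_eq_top _ (LinearMap.range_eq_top.2 h)]

theorem ker_map_eq (V : PersistenceVectorSpace.{u, v} F) {r s t : ℝ} (hrs : r ≤ s)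
    (hst : s ≤ t) (h : Function.Injective (V.map hst)) :
    LinearMap.ker (V.map (hrs.trans hst)) = LinearMap.ker (V.map hrs) := by
  rw [← V.map_comp hrs hst, LinearMap.ker_comp_of_ker_eq_bot _ (LinearMap.ker_eq_bot.2 h)]

theorem rank_eq_left (V : PersistenceVectorSpace.{u, v} F) {C : Finset ℝ} (hC : V.IsCriticalSet C)
    {r s t : ℝ} (hrs : r ≤ s) (hst : s ≤ t) (h : ∀ c ∈ C, ¬(r < c ∧ c ≤ s)) :
    V.rank r t = V.rank s t := by
  rw [V.rank_of_le (hrs.trans hst), V.rank_of_le hst, V.range_map_eq hrs hst (hC hrs h).2]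

theorem rank_eq_right (V : PersistenceVectorSpace.{u, v} F) {C : Finset ℝ}
    (hC : V.IsCriticalSet C) {r s t : ℝ} (hrs : r ≤ s) (hst : s ≤ t)
    (h : ∀ c ∈ C, ¬(s < c ∧ c ≤ t)) : V.rank r s = V.rank r t := by
  rw [V.rank_of_le (hrs.trans hst), V.rank_of_le hrs, ← V.map_comp hrs hst, LinearMap.range_comp]
  exact (Submodule.equivMapOfInjective _ (hC hst h).1 _).finrank_eq

/-- Maps between parameters in `[s, b)` are isomorphisms, so the increasing union of images is
already attained at `s`. -/
theorem olderThan_eq_range (V : PersistenceVectorSpace.{u, v} F) {C : Finset ℝ}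
    (hC : V.IsCriticalSet C) {s b : ℝ} (hsb : s < b) (h : ∀ c ∈ C, ¬(s < c ∧ c < b)) :
    V.olderThan b = LinearMap.range (V.map hsb.le) := by
  apply le_antisymm
  · refine iSup₂_le fun r hr => ?_
    rcases le_total r s with hrs | hsr
    · exact V.range_map_mono hrs hsb.le
    · rw [← V.range_map_eq hsr hr.le (hC hsr fun c hc hc' => h c hc ⟨hc'.1, hc'.2.trans_lt hr⟩).2]
  · exact le_iSup₂_of_le s hsb le_rfl

theorem deadAt_coe (V : PersistenceVectorSpace.{u, v} F) {b e : ℝ} (hbe : b ≤ e) :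
    V.deadAt b (e : WithTop ℝ) = LinearMap.ker (V.map hbe) := by
  apply le_antisymm
  · exact iInf_le_of_le e (iInf₂_le hbe le_rfl)
  · refine le_iInf fun t => le_iInf₂ fun hbt het => ?_
    exact V.ker_map_mono hbe (WithTop.coe_le_coe.1 het)

theorem deadBefore_coe (V : PersistenceVectorSpace.{u, v} F) {C : Finset ℝ}
    (hC : V.IsCriticalSet C) {b t e : ℝ} (hbt : b ≤ t) (hte : t < e)
    (h : ∀ c ∈ C, ¬(t < c ∧ c < e)) :
    V.deadBefore b (e : WithTop ℝ) = LinearMap.ker (V.map hbt) := by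
  apply le_antisymm
  · refine iSup_le fun r => iSup₂_le fun hbr hre => ?_
    rw [WithTop.coe_lt_coe] at hre
    rcases le_total r t with hrt | htr
    · exact V.ker_map_mono hbr hrt
    · rw [← V.ker_map_eq hbt htr (hC htr fun c hc hc' => h c hc ⟨hc'.1, hc'.2.trans_lt hre⟩).1]
  · exact le_iSup_of_le t (le_iSup₂_of_le hbt (WithTop.coe_lt_coe.2 hte) le_rfl)

theorem deadBefore_le_deadAt (V : PersistenceVectorSpace.{u, v} F) (b : ℝ) (e : WithTop ℝ) :
    V.deadBefore b e ≤ V.deadAt b e := by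
  refine iSup_le fun r => iSup₂_le fun hbr hre => le_iInf fun t => le_iInf₂ fun hbt het => ?_
  exact V.ker_map_mono hbr (WithTop.coe_lt_coe.1 (hre.trans_le het)).le

theorem multiplicity_eq_zero_of_le (V : PersistenceVectorSpace.{u, v} F) {b : ℝ} {e : WithTop ℝ}
    (h : V.deadAt b e ≤ (V.olderThan b ⊓ V.deadAt b e) ⊔ V.deadBefore b e) :
    V.multiplicity b e = 0 := by
  have : ((V.olderThan b ⊓ V.deadAt b e) ⊔ V.deadBefore b e).submoduleOf (V.deadAt b e) = ⊤ :=
    Submodule.submoduleOf_eq_top.2 h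
  rw [multiplicity, this]
  exact Module.finrank_zero_of_subsingleton

theorem multiplicity_eq_zero_of_olderThan (V : PersistenceVectorSpace.{u, v} F) {b : ℝ}
    (e : WithTop ℝ) (h : V.olderThan b = ⊤) : V.multiplicity b e = 0 := by
  apply V.multiplicity_eq_zero_of_le
  rw [h, top_inf_eq]
  exact le_sup_left

end PersistenceVectorSpace

/-! ### Step functions and dimension counts -/

theorem Finset.exists_lt_forall_not_between (C : Finset ℝ) {a b : ℝ} (hab : a < b) :
    ∃ s, a ≤ s ∧ s < b ∧ ∀ c ∈ C, ¬(s < c ∧ c < b) := by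
  obtain ⟨s, hs, hmax⟩ := (insert a (C.filter fun c => a < c ∧ c < b)).exists_max_image id
    (Finset.insert_nonempty _ _)
  have hs' : a ≤ s ∧ s < b := by
    rcases Finset.mem_insert.1 hs with rfl | h
    · exact ⟨le_rfl, hab⟩
    · exact ⟨(Finset.mem_filter.1 h).2.1.le, (Finset.mem_filter.1 h).2.2⟩
  refine ⟨s, hs'.1, hs'.2, fun c hc hc' => ?_⟩
  have := hmax c (Finset.mem_insert_of_mem
    (Finset.mem_filter.2 ⟨hc, hs'.1.trans_lt hc'.1, hc'.2⟩))
  exact absurd hc'.1 (not_lt.2 this)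

/-- A step function with jumps `m c` at the points `c` of a finite set. -/
theorem Finset.sum_jumps (C : Finset ℝ) (H m : ℝ → ℤ) {A B : ℝ} (hAB : A ≤ B)
    (hconst : ∀ s t, A ≤ s → s ≤ t → t ≤ B → (∀ c ∈ C, ¬(s < c ∧ c ≤ t)) → H s = H t)
    (hjump : ∀ s c, c ∈ C → A ≤ s → s < c → c ≤ B → (∀ c' ∈ C, ¬(s < c' ∧ c' < c)) →
      H c - H s = m c) :
    ∑ c ∈ C with A < c ∧ c ≤ B, m c = H B - H A := by
  induction hn : (C.filter fun c => A < c ∧ c ≤ B).card generalizing B with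
  | zero =>
    rw [Finset.card_eq_zero] at hn
    rw [hn, Finset.sum_empty, hconst A B le_rfl hAB le_rfl, sub_self]
    intro c hc hc'
    exact Finset.notMem_empty c (hn ▸ Finset.mem_filter.2 ⟨hc, hc'⟩)
  | succ n ih =>
    obtain ⟨c, hc, hmax⟩ := (C.filter fun c => A < c ∧ c ≤ B).exists_max_image id
      (Finset.card_pos.1 (by omega))
    have hc' := Finset.mem_filter.1 hc
    -- Strip off the largest jump `c`: up to a parameter `s` just before it the induction hypothesis
    -- applies, and after it `H` is constant.
    obtain ⟨s, hAs, hsc, hs⟩ := C.exists_lt_forall_not_between hc'.2.1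
    have hfilter : (C.filter fun x => A < x ∧ x ≤ s) =
        (C.filter fun x => A < x ∧ x ≤ B).erase c := by
      ext x
      simp only [Finset.mem_filter, Finset.mem_erase]
      constructor
      · rintro ⟨hx, hAx, hxs⟩
        exact ⟨(hxs.trans_lt hsc).ne, hx, hAx, (hxs.trans hsc.le).trans hc'.2.2⟩
      · rintro ⟨hxc, hx, hAx, hxB⟩
        have hle : x ≤ c := hmax x (Finset.mem_filter.2 ⟨hx, hAx, hxB⟩)
        exact ⟨hx, hAx, not_lt.1 fun h => hs x hx ⟨h, lt_of_le_of_ne hle hxc⟩⟩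
    have hsB : s ≤ B := hsc.le.trans hc'.2.2
    have h := ih hAs (fun s' t' h₁ h₂ h₃ => hconst s' t' h₁ h₂ (h₃.trans hsB))
      (fun s' c' h₀ h₁ h₂ h₃ => hjump s' c' h₀ h₁ h₂ (h₃.trans hsB))
      (by rw [hfilter, Finset.card_erase_of_mem hc, hn]; rfl)
    rw [← Finset.sum_erase_add _ _ hc, ← hfilter, h, ← hjump s c hc'.1 hAs hsc hc'.2.2 hs,
      hconst c B hc'.2.1.le hc'.2.2 le_rfl]
    · ring
    · intro x hx hx'
      have := hmax x (Finset.mem_filter.2 ⟨hx, hc'.2.1.trans hx'.1, hx'.2⟩)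
      exact absurd hx'.1 (not_lt.2 this)

/-- Rank–nullity for `g` restricted to the range of `f`. -/
theorem LinearMap.finrank_range_inf_ker_add {F : Type*} [Field F] {A B C : Type*} [AddCommGroup A]
    [Module F A] [AddCommGroup B] [Module F B] [AddCommGroup C] [Module F C]
    [FiniteDimensional F B] (f : A →ₗ[F] B) (g : B →ₗ[F] C) :
    Module.finrank F (LinearMap.range f ⊓ LinearMap.ker g : Submodule F B) +
      Module.finrank F (LinearMap.range (g.comp f)) = Module.finrank F (LinearMap.range f) := by
  have h := (g.domRestrict (LinearMap.range f)).finrank_range_add_finrank_ker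
  have h₁ : LinearMap.range (g.domRestrict (LinearMap.range f)) = LinearMap.range (g.comp f) := by
    rw [LinearMap.range_domRestrict, LinearMap.range_comp]
  have h₂ : LinearMap.ker (g.domRestrict (LinearMap.range f)) =
      (LinearMap.range f ⊓ LinearMap.ker g).submoduleOf (LinearMap.range f) := by
    ext x
    simp [Submodule.submoduleOf]
  rw [h₁, h₂, (Submodule.submoduleOfEquivOfLe inf_le_left).finrank_eq] at h
  omega

theorem Submodule.finrank_quotient_submoduleOf_add {F : Type*} [Field F] {A : Type*}
    [AddCommGroup A] [Module F A] [FiniteDimensional F A] {O K K' : Submodule F A} (h : K' ≤ K) :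
    Module.finrank F (K ⧸ ((O ⊓ K) ⊔ K').submoduleOf K) + Module.finrank F K' +
      Module.finrank F (O ⊓ K : Submodule F A) =
      Module.finrank F K + Module.finrank F (O ⊓ K' : Submodule F A) := by
  have h₁ := (((O ⊓ K) ⊔ K').submoduleOf K).finrank_quotient_add_finrank
  rw [(Submodule.submoduleOfEquivOfLe (sup_le inf_le_right h)).finrank_eq] at h₁
  have h₂ := Submodule.finrank_sup_add_finrank_inf_eq (O ⊓ K) K'
  rw [inf_assoc, inf_eq_right.2 h] at h₂
  omega

/-! ### Multiplicities as alternating sums of ranks -/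

namespace PersistenceVectorSpace

variable {F : Type u} [Field F]

theorem IsCriticalSet.multiplicity_eq_zero_of_birth {V : PersistenceVectorSpace.{u, v} F}
    {C : Finset ℝ} (hC : V.IsCriticalSet C) {b : ℝ} (hb : b ∉ C) (e : WithTop ℝ) :
    V.multiplicity b e = 0 := by
  obtain ⟨s, -, hsb, hs⟩ := C.exists_lt_forall_not_between (sub_one_lt b)
  apply V.multiplicity_eq_zero_of_olderThan
  rw [V.olderThan_eq_range hC hsb hs, LinearMap.range_eq_top]
  exact (hC hsb.le fun c hc hc' => hs c hc
    ⟨hc'.1, lt_of_le_of_ne hc'.2 fun h => hb (h ▸ hc)⟩).2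

theorem IsCriticalSet.multiplicity_eq_zero_of_death {V : PersistenceVectorSpace.{u, v} F}
    {C : Finset ℝ} (hC : V.IsCriticalSet C) {b e : ℝ} (hbe : b < e) (he : e ∉ C) :
    V.multiplicity b e = 0 := by
  obtain ⟨t, hbt, hte, ht⟩ := C.exists_lt_forall_not_between hbe
  apply V.multiplicity_eq_zero_of_le
  rw [V.deadBefore_coe hC hbt hte ht, V.deadAt_coe hbe.le, V.ker_map_eq hbt hte.le]
  · exact le_sup_right
  · exact (hC hte.le fun c hc hc' => ht c hc
      ⟨hc'.1, lt_of_le_of_ne hc'.2 fun h => he (h ▸ hc)⟩).1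

/-- With `s` just before `b` and `t` just before `e`, the spaces defining the multiplicity are the
range of `V_s → V_b` and the kernels of `V_b → V_e` and `V_b → V_t`. Rank–nullity turns their
dimensions, and those of their intersections, into ranks. -/
theorem IsCriticalSet.multiplicity_eq {V : PersistenceVectorSpace.{u, v} F}
    [∀ r, FiniteDimensional F (V.space r)] {C : Finset ℝ} (hC : V.IsCriticalSet C)
    {s b t e : ℝ} (hsb : s < b) (hbt : b ≤ t) (hte : t < e) (hs : ∀ c ∈ C, ¬(s < c ∧ c < b))
    (ht : ∀ c ∈ C, ¬(t < c ∧ c < e)) :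
    (V.multiplicity b e : ℤ) = V.rank b t - V.rank s t - V.rank b e + V.rank s e := by
  have hbe : b ≤ e := hbt.trans hte.le
  have h := Submodule.finrank_quotient_submoduleOf_add (O := V.olderThan b)
    (V.deadBefore_le_deadAt b e)
  have h₁ := LinearMap.finrank_range_inf_ker_add (V.map hsb.le) (V.map hbe)
  have h₂ := LinearMap.finrank_range_inf_ker_add (V.map hsb.le) (V.map hbt)
  have h₃ := (V.map hbe).finrank_range_add_finrank_ker
  have h₄ := (V.map hbt).finrank_range_add_finrank_ker
  rw [V.map_comp] at h₁ h₂
  rw [V.deadBefore_coe hC hbt hte ht, V.deadAt_coe hbe, V.olderThan_eq_range hC hsb hs] at h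
  rw [multiplicity, V.deadBefore_coe hC hbt hte ht, V.deadAt_coe hbe,
    V.olderThan_eq_range hC hsb hs, V.rank_of_le hbt, V.rank_of_le (hsb.le.trans hbt),
    V.rank_of_le hbe, V.rank_of_le (hsb.le.trans hbe)]
  omega

/-- The number of points of the diagram in a box, in terms of the ranks at its corners. -/
theorem IsCriticalSet.sum_multiplicity {V : PersistenceVectorSpace.{u, v} F}
    [∀ r, FiniteDimensional F (V.space r)] {C : Finset ℝ} (hC : V.IsCriticalSet C)
    {s₀ s₁ t₀ t₁ : ℝ} (hs : s₀ ≤ s₁) (hst : s₁ ≤ t₀) (ht : t₀ ≤ t₁) :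
    ∑ b ∈ C with s₀ < b ∧ b ≤ s₁, ∑ e ∈ C with t₀ < e ∧ e ≤ t₁, (V.multiplicity b e : ℤ) =
      V.rank s₁ t₀ - V.rank s₀ t₀ - V.rank s₁ t₁ + V.rank s₀ t₁ := by
  -- A double telescoping: the inner sum over deaths is the jump at `b` of the difference of ranks
  -- towards `t₀` and `t₁`.
  rw [C.sum_jumps (fun x => (V.rank x t₀ : ℤ) - V.rank x t₁) _ hs]
  · ring
  · intro s t _ hst' ht' h
    rw [V.rank_eq_left hC hst' (ht'.trans hst) h,
      V.rank_eq_left hC hst' ((ht'.trans hst).trans ht) h]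
  · intro s b _ _ hsb hb h
    have hbt₀ : b ≤ t₀ := hb.trans hst
    rw [C.sum_jumps (fun y => (V.rank s y : ℤ) - V.rank b y) _ ht]
    · ring
    · intro x y hx hxy _ h'
      rw [V.rank_eq_right hC (hbt₀.trans hx) hxy h',
        V.rank_eq_right hC (hsb.le.trans (hbt₀.trans hx)) hxy h']
    · intro t e _ ht' hte _ h'
      rw [hC.multiplicity_eq hsb (hbt₀.trans ht') hte h h']
      ring

end PersistenceVectorSpace

/-! ### Subquotients -/

namespace Subquotient

variable {F : Type u} [Field F] {A : Type w} [AddCommGroup A] [Module F A]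

theorem map_bijective_of_eq {Z B Z' B' : Submodule F A} (hZ : Z ≤ Z') (hB : B ≤ B') (hZ' : Z = Z')
    (hB' : B = B') : Function.Bijective (Subquotient.map hZ hB) := by
  subst hZ' hB'
  have : ⇑(Subquotient.map hZ hB) = id := funext fun x => Subquotient.map_refl x
  rw [this]
  exact Function.bijective_id

theorem map_surjective {Z B Z' B' : Submodule F A} (hZ : Z ≤ Z') (hB : B ≤ B') (hZ' : Z' ≤ Z) :
    Function.Surjective (Subquotient.map hZ hB) := by
  intro y
  induction y using Submodule.Quotient.induction_on with
  | _ z => exact ⟨Submodule.Quotient.mk ⟨z, hZ' z.2⟩, rfl⟩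

theorem finrank_range_map_congr {Z B Z' B' Z₁ B₁ Z₁' B₁' : Submodule F A} (hZ : Z ≤ Z')
    (hB : B ≤ B') (hZ₁ : Z₁ ≤ Z₁') (hB₁ : B₁ ≤ B₁') (h₁ : Z = Z₁) (h₂ : B = B₁) (h₃ : Z' = Z₁')
    (h₄ : B' = B₁') :
    Module.finrank F (LinearMap.range (Subquotient.map hZ hB)) =
      Module.finrank F (LinearMap.range (Subquotient.map hZ₁ hB₁)) := by
  subst h₁ h₂ h₃ h₄
  rfl

theorem subsingleton_of_le {Z B : Submodule F A} (h : Z ≤ B) : Subsingleton (Subquotient Z B) :=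
  Submodule.Quotient.subsingleton_iff.2 (Submodule.submoduleOf_eq_top.2 h)

theorem finrank_eq_one {Z B : Submodule F A} {z : A} (hz : z ∈ Z) (hzB : z ∉ B)
    (h : ∀ c ∈ Z, ∃ a : F, a • z - c ∈ B) : Module.finrank F (Subquotient Z B) = 1 := by
  change Module.finrank F (Z ⧸ B.submoduleOf Z) = 1
  refine _root_.finrank_eq_one (Submodule.Quotient.mk ⟨z, hz⟩) ?_ ?_
  · rw [Ne, Submodule.Quotient.mk_eq_zero]
    exact hzB
  · intro w
    induction w using Submodule.Quotient.induction_on with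
    | _ c =>
      obtain ⟨a, ha⟩ := h c c.2
      exact ⟨a, (Submodule.Quotient.eq _).2 ha⟩

instance [FiniteDimensional F A] (Z B : Submodule F A) : FiniteDimensional F (Subquotient Z B) :=
  inferInstanceAs (FiniteDimensional F (Z ⧸ B.submoduleOf Z))

end Subquotient

/-! ### Vietoris–Rips homology at particular scales -/

namespace VietorisRips

variable (F : Type u) [Field F] {ι : Type w}

theorem chains_congr {d d' : ι → ι → ℝ} {r r' : ℝ} (h : ∀ i j, d i j ≤ r ↔ d' i j ≤ r') (k : ℕ) :
    chains F d k r = chains F d' k r' := by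
  have : simplices d k r = simplices d' k r' := by
    ext x
    exact forall₂_congr fun i j => h _ _
  rw [chains, chains, this]

theorem cycles_congr {d d' : ι → ι → ℝ} {r r' : ℝ} (h : ∀ i j, d i j ≤ r ↔ d' i j ≤ r') (k : ℕ) :
    cycles F d k r = cycles F d' k r' := by
  cases k with
  | zero => exact chains_congr F h 0
  | succ k => exact congrArg (· ⊓ _) (chains_congr F h (k + 1))

theorem boundaries_congr {d d' : ι → ι → ℝ} {r r' : ℝ} (h : ∀ i j, d i j ≤ r ↔ d' i j ≤ r')
    (k : ℕ) : boundaries F d k r = boundaries F d' k r' :=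
  congrArg (Submodule.map _) (chains_congr F h (k + 1))

theorem homologyMap_bijective {d : ι → ι → ℝ} {s t : ℝ} (h : ∀ i j, d i j ≤ s ↔ d i j ≤ t)
    (hst : s ≤ t) (k : ℕ) : Function.Bijective (homologyMap F d k hst) :=
  Subquotient.map_bijective_of_eq (cycles_mono F d k hst) (boundaries_mono F d k hst)
    (cycles_congr F h k) (boundaries_congr F h k)

theorem isCriticalSet {d : ι → ι → ℝ} {C : Finset ℝ} (hC : ∀ i j, d i j ∈ C) (k : ℕ) :
    (persistentHomology F d k).IsCriticalSet C := by
  intro s t hst h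
  exact homologyMap_bijective F (fun i j =>
    ⟨fun hs => hs.trans hst, fun ht => not_lt.1 fun hs => h _ (hC i j) ⟨hs, ht⟩⟩) hst k

/-- This is how the diagrams of two dissimilarities are compared: a rank sees only the sublevel
relations at its two parameters. -/
theorem rank_congr {d d' : ι → ι → ℝ} {s t : ℝ} (hs : ∀ i j, d i j ≤ s ↔ d' i j ≤ s)
    (ht : ∀ i j, d i j ≤ t ↔ d' i j ≤ t) (k : ℕ) :
    (persistentHomology F d k).rank s t = (persistentHomology F d' k).rank s t := by
  by_cases hst : s ≤ t
  · rw [PersistenceVectorSpace.rank_of_le _ hst, PersistenceVectorSpace.rank_of_le _ hst]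
    exact Subquotient.finrank_range_map_congr (cycles_mono F d k hst) (boundaries_mono F d k hst)
      (cycles_mono F d' k hst) (boundaries_mono F d' k hst) (cycles_congr F hs k)
      (boundaries_congr F hs k) (cycles_congr F ht k) (boundaries_congr F ht k)
  · simp only [PersistenceVectorSpace.rank, dif_neg hst]

instance [Finite ι] (d : ι → ι → ℝ) (k : ℕ) (r : ℝ) :
    FiniteDimensional F ((persistentHomology F d k).space r) :=
  inferInstanceAs (FiniteDimensional F (Subquotient _ _))

theorem boundary_single (k : ℕ) (x : Fin (k + 2) → ι) (a : F) :
    boundary F ι k (Finsupp.single x a) =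
      ∑ i : Fin (k + 2), (-1 : F) ^ (i : ℕ) • Finsupp.single (fun j => x (i.succAbove j)) a := by
  simp [boundary]

/-- The cone operator on ordered chains whose apex depends on the first vertex. -/
noncomputable def cone (ρ : ι → ι) (k : ℕ) :
    ((Fin (k + 1) → ι) →₀ F) →ₗ[F] ((Fin (k + 2) → ι) →₀ F) :=
  Finsupp.lmapDomain F F fun x => Fin.cons (ρ (x 0)) x

theorem cone_single (ρ : ι → ι) (k : ℕ) (x : Fin (k + 1) → ι) (a : F) :
    cone F ρ k (Finsupp.single x a) = Finsupp.single (Fin.cons (ρ (x 0)) x : Fin (k + 2) → ι) a :=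
  Finsupp.mapDomain_single

/-- The cone is a chain homotopy from the identity to zero. Removing the first vertex of `x` changes
the apex from `ρ (x 0)` to `ρ (x 1)`, which is why these must agree. -/
theorem boundary_cone_single (ρ : ι → ι) (k : ℕ) (x : Fin (k + 2) → ι) (a : F)
    (hx : ρ (x 0) = ρ (x 1)) :
    boundary F ι (k + 1) (cone F ρ (k + 1) (Finsupp.single x a)) +
      cone F ρ k (boundary F ι k (Finsupp.single x a)) = Finsupp.single x a := by
  rw [cone_single, boundary_single, boundary_single, map_sum, Fin.sum_univ_succ (n := k + 2)]
  refine (add_assoc _ _ _).trans ?_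
  -- The face opposite the apex is `x`; every other face of the cone cancels the cone over a face of
  -- `x`.
  rw [← Finset.sum_add_distrib, Finset.sum_eq_zero, add_zero]
  · simp
  · intro i _
    rw [map_smul, cone_single, Fin.val_succ, pow_succ, mul_neg_one, neg_smul, neg_add_eq_zero]
    congr 2
    ext j
    refine Fin.cases ?_ (fun j => ?_) j
    · rw [Fin.succ_succAbove_zero, Fin.cons_zero, Fin.cons_zero]
      refine Fin.cases ?_ (fun i => ?_) i
      · rw [hx]; rfl
      · rw [Fin.succ_succAbove_zero]
    · rw [Fin.succ_succAbove_succ, Fin.cons_succ, Fin.cons_succ]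

theorem subsingleton_homology_succ {d : ι → ι → ℝ} {k : ℕ} {r : ℝ} (ρ : ι → ι)
    (hρ : ∀ x ∈ simplices d (k + 1) r, ρ (x 0) = ρ (x 1) ∧
      (Fin.cons (ρ (x 0)) x : Fin (k + 3) → ι) ∈ simplices d (k + 2) r) :
    Subsingleton (Homology F d (k + 1) r) := by
  have key : ∀ c ∈ chains F d (k + 1) r, cone F ρ (k + 1) c ∈ chains F d (k + 2) r ∧
      boundary F ι (k + 1) (cone F ρ (k + 1) c) + cone F ρ k (boundary F ι k c) = c := by
    intro c hc
    rw [chains, Finsupp.supported_eq_span_single] at hc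
    induction hc using Submodule.span_induction with
    | mem c hc =>
      obtain ⟨x, hx, rfl⟩ := hc
      refine ⟨?_, boundary_cone_single F ρ k x 1 (hρ x hx).1⟩
      rw [cone_single]
      exact Finsupp.single_mem_supported F 1 (hρ x hx).2
    | zero => simp
    | add c c' _ _ h h' =>
      refine ⟨?_, ?_⟩
      · rw [map_add]; exact add_mem h.1 h'.1
      · conv_rhs => rw [← h.2, ← h'.2]
        simp only [map_add]
        abel
    | smul a c _ h =>
      refine ⟨?_, ?_⟩
      · rw [map_smul]; exact Submodule.smul_mem _ _ h.1
      · conv_rhs => rw [← h.2]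
        simp only [map_smul, smul_add]
  refine Subquotient.subsingleton_of_le fun c hc => ?_
  obtain ⟨h₁, h₂⟩ := key c hc.1
  rw [LinearMap.mem_ker.1 hc.2, map_zero, add_zero] at h₂
  exact ⟨_, h₁, h₂⟩

theorem subsingleton_homology_of_forall_le {d : ι → ι → ℝ} {r : ℝ} (h : ∀ i j, d i j ≤ r) (k : ℕ) :
    Subsingleton (Homology F d (k + 1) r) := by
  rcases isEmpty_or_nonempty ι with hι | ⟨⟨i₀⟩⟩
  · exact subsingleton_homology_succ F id fun x _ => hι.elim (x 0)
  · exact subsingleton_homology_succ F (fun _ => i₀) fun x _ => ⟨rfl, fun i j => h _ _⟩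

/-- Points may coincide, so at scale 0 the complex is a disjoint union of full simplices, one for
each position. Coning each off to a chosen index at that position kills the homology of positive
degree. -/
theorem subsingleton_homology_cloudDist_zero {E : Type v} [MetricSpace E] (Y : ι → E)
    (k : ℕ) : Subsingleton (Homology F (cloudDist Y) (k + 1) 0) := by
  have hY : ∀ i, Y (Set.rangeSplitting Y ⟨Y i, i, rfl⟩) = Y i := fun i =>
    Set.apply_rangeSplitting Y _
  refine subsingleton_homology_succ F (fun i => Set.rangeSplitting Y ⟨Y i, i, rfl⟩)
    fun x hx => ?_
  have hx' : ∀ i j, Y (x i) = Y (x j) := fun i j => dist_le_zero.1 (hx i j)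
  refine ⟨by simp only [hx' 0 1], ?_⟩
  have h : ∀ i, Y ((Fin.cons (Set.rangeSplitting Y ⟨Y (x 0), x 0, rfl⟩) x : Fin (k + 3) → ι) i) =
      Y (x 0) := Fin.cases (hY _) fun i => hx' i 0
  exact fun i j => dist_le_zero.2 ((h i).trans (h j).symm)

theorem finrank_homology_zero [Nonempty ι] {d : ι → ι → ℝ} {r : ℝ} (h : ∀ i j, d i j ≤ r) :
    Module.finrank F (Homology F d 0 r) = 1 := by
  obtain ⟨i₀⟩ := ‹Nonempty ι›
  have hmem : ∀ (k : ℕ) (c : (Fin (k + 1) → ι) →₀ F), c ∈ chains F d k r := fun k c x _ i j => h _ _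
  -- The augmentation vanishes on boundaries, so a vertex is not a boundary; conversely (`hspan`) a
  -- chain is determined by its augmentation modulo boundaries.
  have hε : ∀ c ∈ boundaries F d 0 r, Finsupp.linearCombination F (fun _ => (1 : F)) c = 0 := by
    rintro _ ⟨c, -, rfl⟩
    induction c using Finsupp.induction_linear with
    | zero => simp
    | add c c' h h' => rw [map_add, map_add, h, h', add_zero]
    | single x a =>
      rw [boundary_single, Fin.sum_univ_two, map_add, map_smul, map_smul,
        Finsupp.linearCombination_single, Finsupp.linearCombination_single]
      simp
  have hspan : ∀ c : (Fin 1 → ι) →₀ F, Finsupp.linearCombination F (fun _ => (1 : F)) c •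
      Finsupp.single (fun _ => i₀) 1 - c ∈ boundaries F d 0 r := by
    intro c
    induction c using Finsupp.induction_linear with
    | zero => simp
    | add c c' h h' =>
      rw [map_add, add_smul, add_sub_add_comm]
      exact add_mem h h'
    | single x a =>
      refine ⟨Finsupp.single ![x 0, i₀] a, hmem _ _, ?_⟩
      have h₁ : (fun _ => x 0) = x := by
        ext j
        rw [Subsingleton.elim j 0]
      have h₂ : (fun j : Fin 1 => ![x 0, i₀] (Fin.succAbove 1 j)) = x := by
        ext j
        rw [Subsingleton.elim j 0]
        rfl
      have h₃ : (fun j : Fin 1 => ![x 0, i₀] (Fin.succAbove 0 j)) = fun _ => i₀ := by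
        ext j
        rw [Subsingleton.elim j 0]
        rfl
      rw [boundary_single, Fin.sum_univ_two, h₂, h₃]
      simp [sub_eq_add_neg]
  refine Subquotient.finrank_eq_one (hmem 0 (Finsupp.single (fun _ => i₀) 1)) (fun h1 => ?_)
    fun c _ => ⟨_, hspan c⟩
  have h2 := hε _ h1
  rw [Finsupp.linearCombination_single] at h2
  simp at h2

variable {d : ι → ι → ℝ}

theorem subsingleton_homology_zero_of_neg (hd : ∀ i, 0 ≤ d i i) {r : ℝ} (hr : r < 0) :
    Subsingleton (Homology F d 0 r) := by
  refine Subquotient.subsingleton_of_le fun c hc => ?_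
  have : c = 0 := by
    rw [← Finsupp.support_eq_empty, Finset.eq_empty_iff_forall_notMem]
    intro x hx
    exact absurd ((hd _).trans (hc hx 0 0)) (not_le.2 hr)
  rw [this]
  exact zero_mem _

theorem homologyMap_zero_surjective (hd : ∀ i, d i i ≤ 0) {r s : ℝ} (hr : 0 ≤ r) (hrs : r ≤ s) :
    Function.Surjective (homologyMap F d 0 hrs) := by
  refine Subquotient.map_surjective _ _ fun c _ x _ i j => ?_
  rw [Subsingleton.elim (α := Fin 1) i j]
  exact (hd _).trans hr

/-- The complex is empty before 0 and contains all vertices from 0 on, so every class of degree 0 is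
born at 0. -/
theorem multiplicity_zero_of_ne (hd : ∀ i, d i i = 0) {b : ℝ} (hb : b ≠ 0) (e : WithTop ℝ) :
    (persistentHomology F d 0).multiplicity b e = 0 := by
  apply PersistenceVectorSpace.multiplicity_eq_zero_of_olderThan
  rcases lt_or_gt_of_ne hb with hb | hb
  · have : Subsingleton ((persistentHomology F d 0).space b) :=
      subsingleton_homology_zero_of_neg F (fun i => (hd i).ge) hb
    exact Subsingleton.elim _ _
  · refine top_le_iff.1 (le_iSup₂_of_le 0 hb ?_)
    exact (LinearMap.range_eq_top.2
      (homologyMap_zero_surjective F (fun i => (hd i).le) le_rfl hb.le)).ge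

/-- At a large scale the complex is a full simplex, so every class of positive degree has died by
then. -/
theorem multiplicity_top_succ [Finite ι] (k : ℕ) (b : ℝ) :
    (persistentHomology F d (k + 1)).multiplicity b ⊤ = 0 := by
  obtain ⟨r, hr⟩ := (Set.finite_range fun p : ι × ι => d p.1 p.2).bddAbove
  have hsub : Subsingleton ((persistentHomology F d (k + 1)).space (max r b)) :=
    subsingleton_homology_of_forall_le F
      (fun i j => le_max_of_le_left (hr ⟨(i, j), rfl⟩)) k
  apply PersistenceVectorSpace.multiplicity_eq_zero_of_le
  refine le_sup_of_le_right (le_iSup_of_le (max r b) (le_iSup₂_of_le (le_max_right r b)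
    (WithTop.coe_lt_top _) fun x _ => LinearMap.mem_ker.2 (Subsingleton.elim _ _)))

/-- Nothing is older than 0, and the classes at 0 modulo those that die at a finite parameter form
the homology of the full complex, of dimension 1. -/
theorem multiplicity_zero_top [Finite ι] [Nonempty ι] (hd : ∀ i, d i i = 0) :
    (persistentHomology F d 0).multiplicity 0 ⊤ = 1 := by
  obtain ⟨r, hr⟩ := (Set.finite_range fun p : ι × ι => d p.1 p.2).bddAbove
  have hr' : ∀ i j, d i j ≤ r := fun i j => hr ⟨(i, j), rfl⟩
  have hr0 : 0 ≤ r := by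
    obtain ⟨i⟩ := ‹Nonempty ι›
    exact hd i ▸ hr' i i
  set V := persistentHomology F d 0
  have hO : V.olderThan 0 = ⊥ := by
    refine le_bot_iff.1 (iSup₂_le fun s hs => ?_)
    have : Subsingleton (V.space s) :=
      subsingleton_homology_zero_of_neg F (fun i => (hd i).ge) hs
    rintro _ ⟨x, rfl⟩
    rw [Subsingleton.elim x 0, map_zero]
    exact zero_mem _
  have hA : V.deadAt 0 ⊤ = ⊤ := by
    refine top_le_iff.1 (le_iInf fun t => le_iInf₂ fun _ ht => ?_)
    exact absurd ht (not_le.2 (WithTop.coe_lt_top t))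
  have hB : V.deadBefore 0 ⊤ = LinearMap.ker (V.map hr0) := by
    apply le_antisymm
    · refine iSup_le fun t => iSup₂_le fun h0t _ => ?_
      rcases le_total t r with htr | hrt
      · exact V.ker_map_mono h0t htr
      · rw [← V.ker_map_eq hr0 hrt]
        exact (homologyMap_bijective F (fun i j =>
          iff_of_true (hr' i j) ((hr' i j).trans hrt)) hrt 0).1
    · exact le_iSup_of_le r (le_iSup₂_of_le hr0 (WithTop.coe_lt_top _) le_rfl)
  have h := Submodule.finrank_quotient_submoduleOf_add (O := V.olderThan 0)
    (V.deadBefore_le_deadAt 0 ⊤)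
  have h₁ := (V.map hr0).finrank_range_add_finrank_ker
  have hsurj : LinearMap.range (V.map hr0) = ⊤ :=
    LinearMap.range_eq_top.2 (homologyMap_zero_surjective F (fun i => (hd i).le) le_rfl hr0)
  rw [hsurj, finrank_top] at h₁
  have h₂ : Module.finrank F (V.space r) = 1 := finrank_homology_zero F hr'
  rw [PersistenceVectorSpace.multiplicity]
  rw [hB] at h ⊢
  rw [hO, bot_inf_eq, bot_inf_eq, finrank_bot] at h
  rw [hO, bot_inf_eq]
  have h₃ : Module.finrank F (V.deadAt 0 ⊤) = Module.finrank F (V.space 0) := by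
    rw [hA, finrank_top]
  omega

end VietorisRips

/-! ### Distances of birth–death pairs and transport of matchings -/

theorem deathDist_comm (s t : WithTop ℝ) : deathDist s t = deathDist t s := by
  induction s <;> induction t
  · rfl
  · rfl
  · rfl
  · exact congrArg ENNReal.ofReal (abs_sub_comm _ _)

theorem deathDist_triangle (r s t : WithTop ℝ) : deathDist r t ≤ deathDist r s + deathDist s t := by
  induction s with
  | top =>
    induction r <;> induction t
    · exact zero_le
    · exact le_add_left le_rfl
    · exact le_add_right le_rfl
    · exact le_add_right le_top
  | coe s =>
    induction r <;> induction t
    · exact zero_le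
    · exact le_add_right le_rfl
    · exact le_add_left le_rfl
    · exact (ENNReal.ofReal_le_ofReal (abs_sub_le _ s _)).trans ENNReal.ofReal_add_le

theorem pairDist_comm (p q : ℝ × WithTop ℝ) : pairDist p q = pairDist q p := by
  rw [pairDist, pairDist, abs_sub_comm, deathDist_comm]

theorem pairDist_triangle (p q r : ℝ × WithTop ℝ) :
    pairDist p r ≤ pairDist p q + pairDist q r := by
  apply max_le
  · exact (ENNReal.ofReal_le_ofReal (abs_sub_le _ q.1 _)).trans
      (ENNReal.ofReal_add_le.trans (add_le_add (le_max_left _ _) (le_max_left _ _)))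
  · exact (deathDist_triangle _ q.2 _).trans (add_le_add (le_max_right _ _) (le_max_right _ _))

theorem pairDist_coe_le {b e b' e' M : ℝ} :
    pairDist (b, (e : WithTop ℝ)) (b', (e' : WithTop ℝ)) ≤ ENNReal.ofReal M ↔
      ENNReal.ofReal |b - b'| ≤ ENNReal.ofReal M ∧ ENNReal.ofReal |e - e'| ≤ ENNReal.ofReal M :=
  max_le_iff

theorem pairDist_coe_le_of_nonneg {b e b' e' M : ℝ} (hM : 0 ≤ M) :
    pairDist (b, (e : WithTop ℝ)) (b', (e' : WithTop ℝ)) ≤ ENNReal.ofReal M ↔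
      |b - b'| ≤ M ∧ |e - e'| ≤ M := by
  rw [pairDist_coe_le, ENNReal.ofReal_le_ofReal_iff hM, ENNReal.ofReal_le_ofReal_iff hM]

theorem exists_coe_of_pairDist_ne_top {b e : ℝ} {p : ℝ × WithTop ℝ}
    (h : pairDist (b, (e : WithTop ℝ)) p ≠ ⊤) : ∃ e' : ℝ, p.2 = e' := by
  obtain ⟨b', e'⟩ := p
  induction e' with
  | top => exact absurd (max_eq_right le_top) h
  | coe e' => exact ⟨e', rfl⟩

/-- A point of a diagram is close to the diagonal if its birth and death are close. -/
theorem pairDist_midpoint_le {b e M : ℝ} (hbe : b ≤ e) (h : e - b ≤ 2 * M) :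
    pairDist (b, (e : WithTop ℝ)) ((b + e) / 2, (((b + e) / 2 : ℝ) : WithTop ℝ)) ≤
      ENNReal.ofReal M := by
  refine (pairDist_coe_le_of_nonneg (by linarith)).2 ⟨?_, ?_⟩ <;> rw [abs_le] <;>
    constructor <;> linarith

theorem sub_le_of_pairDist_diagonal_le {b e x M : ℝ} (hM : 0 ≤ M)
    (h : pairDist (b, (e : WithTop ℝ)) (x, (x : WithTop ℝ)) ≤ ENNReal.ofReal M) :
    e - b ≤ 2 * M := by
  obtain ⟨h₁, h₂⟩ := (pairDist_coe_le_of_nonneg hM).1 h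
  linarith [(abs_le.1 h₁).1, (abs_le.1 h₂).2]

/-- Transport of a matching along an injection of the points of one diagram in those of another
one whose other points are close to the diagonal. -/
theorem bottleneckDist_le_of_injective {D₁ D₂ D₃ : PersistenceDiagram}
    {Ω : Set (DiagramPoint D₁ × DiagramPoint D₃)} (hΩ : IsMatching Ω)
    {j : OffDiagonalPoint D₁ → OffDiagonalPoint D₂} (hj : Function.Injective j) {M : ℝ≥0∞}
    (h₁ : ∀ α β, (Sum.inl α, Sum.inl β) ∈ Ω → pairDist (j α).1 β.1 ≤ M)
    (h₂ : ∀ α x, (Sum.inl α, Sum.inr x) ∈ Ω →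
      ∃ y : ℝ, pairDist (j α).1 (y, (y : WithTop ℝ)) ≤ M)
    (h₃ : ∀ (x : ℝ) β, (Sum.inr x, Sum.inl β) ∈ Ω → pairDist (x, (x : WithTop ℝ)) β.1 ≤ M)
    (h₄ : ∀ z, z ∉ Set.range j → ∃ y : ℝ, pairDist z.1 (y, (y : WithTop ℝ)) ≤ M) :
    bottleneckDist D₂ D₃ ≤ M := by
  -- A point of `D₂` gets a diagonal partner `y z` unless it is the image of a point matched off the
  -- diagonal.
  have hy : ∀ z : OffDiagonalPoint D₂, ∃ y : ℝ,
      (∀ α β, (Sum.inl α, Sum.inl β) ∈ Ω → j α ≠ z) → pairDist z.1 (y, (y : WithTop ℝ)) ≤ M := by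
    intro z
    by_cases hz : z ∈ Set.range j
    · obtain ⟨α, rfl⟩ := hz
      obtain ⟨q, hq, -⟩ := hΩ.left α
      rcases q with β | x
      · exact ⟨0, fun h => absurd rfl (h α β hq)⟩
      · obtain ⟨y, hy⟩ := h₂ α x hq
        exact ⟨y, fun _ => hy⟩
    · obtain ⟨y, hy⟩ := h₄ z hz
      exact ⟨y, fun _ => hy⟩
  choose y hy using hy
  let Ω' : Set (DiagramPoint D₂ × DiagramPoint D₃) := {m |
    (∃ α β, (Sum.inl α, Sum.inl β) ∈ Ω ∧ m = (Sum.inl (j α), Sum.inl β)) ∨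
    (∃ (x : ℝ) (β : _), (Sum.inr x, Sum.inl β) ∈ Ω ∧ m = (Sum.inr x, Sum.inl β)) ∨
    ∃ z, (∀ α β, (Sum.inl α, Sum.inl β) ∈ Ω → j α ≠ z) ∧ m = (Sum.inl z, Sum.inr (y z))}
  have hΩ' : IsMatching Ω' := by
    refine ⟨fun z => ?_, fun β => ?_, fun x x' h => ?_⟩
    · by_cases hz : ∀ α β, (Sum.inl α, Sum.inl β) ∈ Ω → j α ≠ z
      · refine ⟨Sum.inr (y z), Or.inr (Or.inr ⟨z, hz, rfl⟩), ?_⟩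
        rintro q (⟨α, β, h, hm⟩ | ⟨x, β, h, hm⟩ | ⟨z', -, hm⟩)
        · simp only [Prod.mk.injEq, Sum.inl.injEq] at hm
          exact absurd hm.1.symm (hz α β h)
        · simp at hm
        · simp only [Prod.mk.injEq, Sum.inl.injEq] at hm
          rw [hm.2, hm.1]
      · push Not at hz
        obtain ⟨α, β, h, rfl⟩ := hz
        refine ⟨Sum.inl β, Or.inl ⟨α, β, h, rfl⟩, ?_⟩
        rintro q (⟨α', β', h', hm⟩ | ⟨x, β', h', hm⟩ | ⟨z', hz', hm⟩)
        · simp only [Prod.mk.injEq, Sum.inl.injEq] at hm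
          obtain rfl := hj hm.1
          rw [hm.2]
          exact (hΩ.left α).unique h' h
        · simp at hm
        · simp only [Prod.mk.injEq, Sum.inl.injEq] at hm
          exact absurd hm.1 (hz' α β h)
    · obtain ⟨p, hp, hp'⟩ := hΩ.right β
      rcases p with α | x
      · refine ⟨Sum.inl (j α), Or.inl ⟨α, β, hp, rfl⟩, ?_⟩
        rintro p (⟨α', β', h', hm⟩ | ⟨x, β', h', hm⟩ | ⟨z', hz', hm⟩)
        · simp only [Prod.mk.injEq, Sum.inl.injEq] at hm
          obtain ⟨rfl, rfl⟩ := hm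
          rw [Sum.inl_injective (hp' _ h')]
        · simp only [Prod.mk.injEq, Sum.inl.injEq] at hm
          obtain ⟨rfl, rfl⟩ := hm
          exact absurd (hp' _ h') (by simp)
        · simp at hm
      · refine ⟨Sum.inr x, Or.inr (Or.inl ⟨x, β, hp, rfl⟩), ?_⟩
        rintro p (⟨α', β', h', hm⟩ | ⟨x, β', h', hm⟩ | ⟨z', hz', hm⟩)
        · simp only [Prod.mk.injEq, Sum.inl.injEq] at hm
          obtain ⟨rfl, rfl⟩ := hm
          exact absurd (hp' _ h') (by simp)
        · simp only [Prod.mk.injEq, Sum.inl.injEq] at hm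
          obtain ⟨rfl, rfl⟩ := hm
          rw [Sum.inr_injective (hp' _ h')]
        · simp at hm
    · rcases h with ⟨α', β', h', hm⟩ | ⟨x, β', h', hm⟩ | ⟨z', hz', hm⟩ <;> simp at hm
  refine (iInf₂_le Ω' hΩ').trans (iSup₂_le fun m hm => ?_)
  rcases hm with ⟨α, β, h, rfl⟩ | ⟨x, β, h, rfl⟩ | ⟨z, hz, rfl⟩
  · exact h₁ α β h
  · exact h₃ x β h
  · exact hy z hz

/-! ### Counting points of a diagram with multiplicity -/

theorem PersistenceDiagram.card_offDiagonalPoint {D : PersistenceDiagram} {S : Set (ℝ × WithTop ℝ)}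
    {T : Finset (ℝ × WithTop ℝ)} (hTS : ∀ p ∈ T, p ∈ S) (hST : ∀ p ∈ S, D p ≠ 0 → p ∈ T) :
    Nat.card {z : OffDiagonalPoint D // z.1 ∈ S} = ∑ p ∈ T, D p := by
  let e : {z : OffDiagonalPoint D // z.1 ∈ S} ≃ Σ p : T, Fin (D p) :=
    { toFun := fun z => ⟨⟨z.1.1, hST _ z.2 (Nat.pos_iff_ne_zero.1 z.1.2.pos)⟩, z.1.2⟩
      invFun := fun z => ⟨⟨z.1.1, z.2⟩, hTS _ z.1.2⟩
      left_inv := fun z => rfl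
      right_inv := fun z => rfl }
  rw [Nat.card_congr e, Nat.card_eq_fintype_card, Fintype.card_sigma]
  simp only [Fintype.card_fin]
  exact Finset.sum_coe_sort T D

theorem PersistenceDiagram.finite_offDiagonalPoint {D : PersistenceDiagram}
    {T : Finset (ℝ × WithTop ℝ)} (hT : ∀ p, D p ≠ 0 → p ∈ T) : Finite (OffDiagonalPoint D) := by
  have : Function.Injective fun z : OffDiagonalPoint D =>
      (⟨⟨z.1, hT _ (Nat.pos_iff_ne_zero.1 z.2.pos)⟩, z.2⟩ : Σ p : T, Fin (D p)) := by
    rintro ⟨p, n⟩ ⟨p', n'⟩ h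
    simp only [Sigma.mk.injEq, Subtype.mk.injEq] at h
    obtain ⟨rfl, h⟩ := h
    rw [eq_of_heq h]
  exact Finite.of_injective _ this

/-- Bijections between the copies of `p` and the points in `B p` glue to an injection because the
sets `B p` are disjoint. -/
theorem PersistenceDiagram.exists_injective_of_card_eq {D D' : PersistenceDiagram}
    {B : ℝ × WithTop ℝ → Set (ℝ × WithTop ℝ)}
    (hcard : ∀ p, D p ≠ 0 → Nat.card {z : OffDiagonalPoint D' // z.1 ∈ B p} = D p)
    (hdisj : ∀ p p', D p ≠ 0 → D p' ≠ 0 → ∀ z, z ∈ B p → z ∈ B p' → p = p') :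
    ∃ j : OffDiagonalPoint D → OffDiagonalPoint D', Function.Injective j ∧
      (∀ α, (j α).1 ∈ B α.1) ∧ ∀ z p, D p ≠ 0 → z.1 ∈ B p → z ∈ Set.range j := by
  have e : ∀ p, D p ≠ 0 → Nonempty (Fin (D p) ≃ {z : OffDiagonalPoint D' // z.1 ∈ B p}) := by
    intro p hp
    have h := hcard p hp
    exact ⟨(finCongr h.symm).trans (Nat.equivFinOfCardPos (h ▸ hp)).symm⟩
  have e := fun p hp => Classical.choice (e p hp)
  have hne : ∀ α : OffDiagonalPoint D, D α.1 ≠ 0 := fun α => Nat.pos_iff_ne_zero.1 α.2.pos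
  refine ⟨fun α => (e α.1 (hne α) α.2).1, ?_, fun α => (e α.1 (hne α) α.2).2, ?_⟩
  · rintro ⟨p, n⟩ ⟨p', n'⟩ h
    simp only at h
    obtain rfl : p = p' := by
      refine hdisj p p' (hne ⟨p, n⟩) (hne ⟨p', n'⟩) _ (e p (hne ⟨p, n⟩) n).2 ?_
      rw [h]
      exact (e p' (hne ⟨p', n'⟩) n').2
    rw [(e p (hne ⟨p, n⟩)).injective (Subtype.ext h)]
  · intro z p hp hz
    refine ⟨⟨p, (e p hp).symm ⟨z, hz⟩⟩, ?_⟩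
    simp

/-- The pairs of finite birth and death times in a half-open rectangle. -/
def birthDeathBox (s₀ s₁ t₀ t₁ : ℝ) : Set (ℝ × WithTop ℝ) :=
  {p | (s₀ < p.1 ∧ p.1 ≤ s₁) ∧ (t₀ : WithTop ℝ) < p.2 ∧ p.2 ≤ (t₁ : WithTop ℝ)}

theorem exists_coe_of_mem_birthDeathBox {s₀ s₁ t₀ t₁ : ℝ} {p : ℝ × WithTop ℝ}
    (h : p ∈ birthDeathBox s₀ s₁ t₀ t₁) : ∃ e : ℝ, p.2 = e ∧ t₀ < e ∧ e ≤ t₁ := by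
  obtain ⟨e, he⟩ := WithTop.ne_top_iff_exists.1 (h.2.2.trans_lt (WithTop.coe_lt_top t₁)).ne
  refine ⟨e, he.symm, ?_⟩
  have h' := h.2
  rw [← he] at h'
  exact_mod_cast h'

/-! ### Points of Vietoris–Rips diagrams -/

namespace VietorisRips

variable (F : Type u) [Field F] {ι : Type w} {d d' : ι → ι → ℝ} {k : ℕ}

theorem dgm_apply (d : ι → ι → ℝ) (k : ℕ) {p : ℝ × WithTop ℝ} (h : (p.1 : WithTop ℝ) < p.2) :
    dgm F d k p = (persistentHomology F d k).multiplicity p.1 p.2 :=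
  if_pos h

variable {F}

theorem fst_lt_snd_of_dgm_ne_zero {p : ℝ × WithTop ℝ} (h : dgm F d k p ≠ 0) :
    (p.1 : WithTop ℝ) < p.2 := by
  by_contra hp
  exact h (if_neg hp)

theorem multiplicity_ne_zero_of_dgm_ne_zero {p : ℝ × WithTop ℝ} (h : dgm F d k p ≠ 0) :
    (persistentHomology F d k).multiplicity p.1 p.2 ≠ 0 := by
  rwa [← dgm_apply F d k (fst_lt_snd_of_dgm_ne_zero h)]

theorem fst_mem_of_dgm_ne_zero {C : Finset ℝ} (hC : ∀ i j, d i j ∈ C) {p : ℝ × WithTop ℝ}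
    (h : dgm F d k p ≠ 0) : p.1 ∈ C := by
  by_contra hp
  exact multiplicity_ne_zero_of_dgm_ne_zero h
    ((isCriticalSet F hC k).multiplicity_eq_zero_of_birth hp _)

theorem snd_mem_of_dgm_ne_zero {C : Finset ℝ} (hC : ∀ i j, d i j ∈ C) {b e : ℝ}
    (h : dgm F d k (b, (e : WithTop ℝ)) ≠ 0) : e ∈ C := by
  by_contra hp
  exact multiplicity_ne_zero_of_dgm_ne_zero h ((isCriticalSet F hC k).multiplicity_eq_zero_of_death
    (WithTop.coe_lt_coe.1 (fst_lt_snd_of_dgm_ne_zero h)) hp)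

theorem exists_finset_forall_mem [Finite ι] (d : ι → ι → ℝ) :
    ∃ C : Finset ℝ, (∀ i j, d i j ∈ C) ∧ ∀ c ∈ C, ∃ i j, d i j = c := by
  have h := Set.finite_range fun p : ι × ι => d p.1 p.2
  refine ⟨h.toFinset, fun i j => h.mem_toFinset.2 ⟨(i, j), rfl⟩, fun c hc => ?_⟩
  obtain ⟨p, hp⟩ := h.mem_toFinset.1 hc
  exact ⟨p.1, p.2, hp⟩

theorem exists_eq_fst_of_dgm_ne_zero [Finite ι] {p : ℝ × WithTop ℝ} (h : dgm F d k p ≠ 0) :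
    ∃ i j, d i j = p.1 := by
  obtain ⟨C, hC, hC'⟩ := exists_finset_forall_mem d
  exact hC' _ (fst_mem_of_dgm_ne_zero hC h)

theorem exists_eq_snd_of_dgm_ne_zero [Finite ι] {b e : ℝ}
    (h : dgm F d k (b, (e : WithTop ℝ)) ≠ 0) : ∃ i j, d i j = e := by
  obtain ⟨C, hC, hC'⟩ := exists_finset_forall_mem d
  exact hC' _ (snd_mem_of_dgm_ne_zero hC h)

variable (F) in
theorem finite_offDiagonalPoint_dgm [Finite ι] (d : ι → ι → ℝ) (k : ℕ) :
    Finite (OffDiagonalPoint (dgm F d k)) := by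
  classical
  obtain ⟨C, hC, -⟩ := exists_finset_forall_mem d
  refine PersistenceDiagram.finite_offDiagonalPoint
    (T := C ×ˢ insert ⊤ (C.image fun e : ℝ => (e : WithTop ℝ))) fun p hp => ?_
  rw [Finset.mem_product]
  refine ⟨fst_mem_of_dgm_ne_zero hC hp, ?_⟩
  obtain ⟨b, e⟩ := p
  induction e with
  | top => exact Finset.mem_insert_self _ _
  | coe e =>
    exact Finset.mem_insert_of_mem
      (Finset.mem_image_of_mem _ (snd_mem_of_dgm_ne_zero hC hp))

theorem fst_eq_zero_of_dgm_zero_ne_zero (hd : ∀ i, d i i = 0) {p : ℝ × WithTop ℝ}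
    (h : dgm F d 0 p ≠ 0) : p.1 = 0 := by
  by_contra hp
  exact multiplicity_ne_zero_of_dgm_ne_zero h (multiplicity_zero_of_ne F hd hp _)

theorem fst_ne_zero_of_dgm_cloudDist_succ_ne_zero {E : Type v} [MetricSpace E] {Y : ι → E}
    {p : ℝ × WithTop ℝ} (h : dgm F (cloudDist Y) (k + 1) p ≠ 0) : p.1 ≠ 0 := by
  intro hp
  have : Subsingleton ((persistentHomology F (cloudDist Y) (k + 1)).space 0) :=
    subsingleton_homology_cloudDist_zero F Y k
  refine multiplicity_ne_zero_of_dgm_ne_zero h ?_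
  rw [hp]
  exact PersistenceVectorSpace.multiplicity_eq_zero_of_olderThan _ _ (Subsingleton.elim _ _)

open Classical in
theorem dgm_top [Finite ι] [Nonempty ι] (hd : ∀ i, d i i = 0) (k : ℕ) (b : ℝ) :
    dgm F d k (b, ⊤) = if k = 0 ∧ b = 0 then 1 else 0 := by
  rw [dgm_apply F d k (p := (b, ⊤)) (WithTop.coe_lt_top b)]
  rcases k with _ | k
  · by_cases hb : b = 0
    · rw [if_pos ⟨rfl, hb⟩, hb, multiplicity_zero_top F hd]
    · rw [if_neg (fun h => hb h.2), multiplicity_zero_of_ne F hd hb]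
  · rw [if_neg (fun h => Nat.succ_ne_zero k h.1), multiplicity_top_succ]

theorem card_birthDeathBox [Finite ι] (d : ι → ι → ℝ) (k : ℕ) {s₀ s₁ t₀ t₁ : ℝ} (hs : s₀ ≤ s₁)
    (hst : s₁ ≤ t₀) (ht : t₀ ≤ t₁) :
    (Nat.card {z : OffDiagonalPoint (dgm F d k) // z.1 ∈ birthDeathBox s₀ s₁ t₀ t₁} : ℤ) =
      (persistentHomology F d k).rank s₁ t₀ - (persistentHomology F d k).rank s₀ t₀ -
      (persistentHomology F d k).rank s₁ t₁ + (persistentHomology F d k).rank s₀ t₁ := by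
  classical
  obtain ⟨C, hC, -⟩ := exists_finset_forall_mem d
  rw [← (isCriticalSet F hC k).sum_multiplicity hs hst ht, ← Finset.sum_product',
    PersistenceDiagram.card_offDiagonalPoint (T := Finset.image
      (fun q : ℝ × ℝ => (q.1, (q.2 : WithTop ℝ)))
      ((C.filter fun b => s₀ < b ∧ b ≤ s₁) ×ˢ (C.filter fun e => t₀ < e ∧ e ≤ t₁))),
    Finset.sum_image, Nat.cast_sum]
  · refine Finset.sum_congr rfl fun q hq => ?_
    simp only [Finset.mem_product, Finset.mem_filter] at hq
    rw [dgm_apply]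
    exact WithTop.coe_lt_coe.2 ((hq.1.2.2.trans hst).trans_lt hq.2.2.1)
  · rintro ⟨b, e⟩ - ⟨b', e'⟩ - h
    simpa using h
  · intro p hp
    simp only [Finset.mem_image, Finset.mem_product, Finset.mem_filter] at hp
    obtain ⟨q, ⟨⟨-, hb⟩, -, he⟩, rfl⟩ := hp
    exact ⟨hb, WithTop.coe_lt_coe.2 he.1, WithTop.coe_le_coe.2 he.2⟩
  · rintro ⟨b, e⟩ hp hD
    obtain ⟨e, rfl, he⟩ := exists_coe_of_mem_birthDeathBox hp
    refine Finset.mem_image.2 ⟨(b, e), ?_, rfl⟩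
    simp only [Finset.mem_product, Finset.mem_filter]
    exact ⟨⟨fst_mem_of_dgm_ne_zero hC hD, hp.1⟩, snd_mem_of_dgm_ne_zero hC hD, he⟩

theorem card_birthDeathBox_congr [Finite ι] {s₀ s₁ t₀ t₁ : ℝ} (hs : s₀ ≤ s₁) (hst : s₁ ≤ t₀)
    (ht : t₀ ≤ t₁) (hs₀ : ∀ i j, d i j ≤ s₀ ↔ d' i j ≤ s₀) (hs₁ : ∀ i j, d i j ≤ s₁ ↔ d' i j ≤ s₁)
    (ht₀ : ∀ i j, d i j ≤ t₀ ↔ d' i j ≤ t₀) (ht₁ : ∀ i j, d i j ≤ t₁ ↔ d' i j ≤ t₁) :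
    Nat.card {z : OffDiagonalPoint (dgm F d k) // z.1 ∈ birthDeathBox s₀ s₁ t₀ t₁} =
      Nat.card {z : OffDiagonalPoint (dgm F d' k) // z.1 ∈ birthDeathBox s₀ s₁ t₀ t₁} := by
  have h := card_birthDeathBox (F := F) d k hs hst ht
  have h' := card_birthDeathBox (F := F) d' k hs hst ht
  rw [rank_congr F hs₁ ht₀, rank_congr F hs₀ ht₀, rank_congr F hs₁ ht₁, rank_congr F hs₀ ht₁,
    ← h'] at h
  exact_mod_cast h

end VietorisRips

theorem pairDist_ne_top_iff {p q : ℝ × WithTop ℝ} : pairDist p q ≠ ⊤ ↔ (p.2 = ⊤ ↔ q.2 = ⊤) := by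
  obtain ⟨b, e⟩ := p
  obtain ⟨b', e'⟩ := q
  induction e with
  | top =>
    induction e' with
    | top => exact iff_of_true (max_lt ENNReal.ofReal_lt_top ENNReal.zero_lt_top).ne Iff.rfl
    | coe e' =>
      refine iff_of_false (not_not.2 (max_eq_right le_top)) fun h => ?_
      exact WithTop.coe_ne_top (h.1 rfl)
  | coe e =>
    induction e' with
    | top =>
      refine iff_of_false (not_not.2 (max_eq_right le_top)) fun h => ?_
      exact WithTop.coe_ne_top (h.2 rfl)
    | coe e' =>
      exact iff_of_true (max_lt ENNReal.ofReal_lt_top ENNReal.ofReal_lt_top).ne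
        (iff_of_false WithTop.coe_ne_top WithTop.coe_ne_top)

/-- A neighbourhood of a birth-death pair. -/
def birthDeathNhd (δ : ℝ) : ℝ × WithTop ℝ → Set (ℝ × WithTop ℝ)
  | (b, some e) => birthDeathBox (b - δ) (b + δ) (e - δ) (e + δ)
  | (b, none) => {(b, ⊤)}

theorem pairDist_le_of_mem_birthDeathNhd {δ : ℝ} (hδ : 0 ≤ δ) {p q : ℝ × WithTop ℝ}
    (h : q ∈ birthDeathNhd δ p) : pairDist p q ≤ ENNReal.ofReal δ := by
  obtain ⟨b, e⟩ := p
  induction e with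
  | top =>
    obtain rfl : q = (b, ⊤) := h
    refine max_le ?_ ?_
    · simp
    · exact zero_le
  | coe e =>
    change q ∈ birthDeathBox (b - δ) (b + δ) (e - δ) (e + δ) at h
    obtain ⟨b', e'⟩ := q
    obtain ⟨e', rfl, he⟩ := exists_coe_of_mem_birthDeathBox h
    have hb := h.1
    refine (pairDist_coe_le_of_nonneg hδ).2 ⟨?_, ?_⟩ <;> rw [abs_le] <;> constructor <;>
      simp only at hb <;> linarith

/-! ### Local stability of the diagram -/

namespace VietorisRips

variable {F : Type u} [Field F] {ι : Type w} {d d' : ι → ι → ℝ} {k : ℕ} {δ : ℝ}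

/-- Either inequality forces `d i j < d i₀ j₀`, hence a gap of at least `10 * δ`, and an error of
`δ` cannot carry the value across the level. -/
theorem le_sub_iff_le_sub (hδ : 0 < δ)
    (hgap : ∀ i j i' j', d i j ≠ d i' j' → 10 * δ ≤ |d i j - d i' j'|)
    (hclose : ∀ i j, |d' i j - d i j| ≤ δ) (i₀ j₀ i j : ι) :
    d i j ≤ d i₀ j₀ - 2 * δ ↔ d' i j ≤ d i₀ j₀ - 2 * δ := by
  have h := abs_le.1 (hclose i j)
  constructor <;> intro h' <;>
  · have h₁ : d i j < d i₀ j₀ := by linarith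
    have h₂ := hgap i j i₀ j₀ h₁.ne
    rw [abs_of_neg (sub_neg.2 h₁)] at h₂
    linarith

theorem le_add_iff_le_add (hδ : 0 < δ)
    (hgap : ∀ i j i' j', d i j ≠ d i' j' → 10 * δ ≤ |d i j - d i' j'|)
    (hclose : ∀ i j, |d' i j - d i j| ≤ δ) (i₀ j₀ i j : ι) :
    d i j ≤ d i₀ j₀ + 2 * δ ↔ d' i j ≤ d i₀ j₀ + 2 * δ := by
  have h := abs_le.1 (hclose i j)
  have h₁ : d i j ≤ d i₀ j₀ + 3 * δ → d i j ≤ d i₀ j₀ := by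
    intro h₁
    by_contra! h₂
    have h₃ := hgap i j i₀ j₀ h₂.ne'
    rw [abs_of_pos (sub_pos.2 h₂)] at h₃
    linarith
  constructor <;> intro h' <;> linarith [h₁ (by linarith)]

theorem eq_of_abs_sub_lt (hgap : ∀ i j i' j', d i j ≠ d i' j' → 10 * δ ≤ |d i j - d i' j'|)
    {i j i' j' : ι} (h : |d i j - d i' j'| < 10 * δ) : d i j = d i' j' := by
  by_contra hne
  exact absurd h (not_lt.2 (hgap i j i' j' hne))

/-- The corners of the box are levels at which the two complexes agree, so both diagrams have
equally many points in it; by the gap, all those of the old diagram are copies of its centre. -/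
theorem card_birthDeathNhd [Finite ι]
    (hδ : 0 < δ) (hgap : ∀ i j i' j', d i j ≠ d i' j' → 10 * δ ≤ |d i j - d i' j'|)
    (hclose : ∀ i j, |d' i j - d i j| ≤ δ) {i j i' j' : ι} (h : d i j < d i' j') :
    Nat.card {z : OffDiagonalPoint (dgm F d' k) //
      z.1 ∈ birthDeathNhd (2 * δ) (d i j, (d i' j' : WithTop ℝ))} =
      dgm F d k (d i j, (d i' j' : WithTop ℝ)) := by
  have h₁ := hgap i j i' j' h.ne
  rw [abs_of_neg (sub_neg.2 h)] at h₁
  change Nat.card {z : OffDiagonalPoint (dgm F d' k) // z.1 ∈ birthDeathBox (d i j - 2 * δ)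
    (d i j + 2 * δ) (d i' j' - 2 * δ) (d i' j' + 2 * δ)} = _
  rw [← card_birthDeathBox_congr (by linarith) (by linarith) (by linarith)
    (le_sub_iff_le_sub hδ hgap hclose i j) (le_add_iff_le_add hδ hgap hclose i j)
    (le_sub_iff_le_sub hδ hgap hclose i' j') (le_add_iff_le_add hδ hgap hclose i' j'),
    PersistenceDiagram.card_offDiagonalPoint (T := {(d i j, (d i' j' : WithTop ℝ))}),
    Finset.sum_singleton]
  · intro p hp
    rw [Finset.mem_singleton.1 hp]
    refine ⟨⟨?_, ?_⟩, WithTop.coe_lt_coe.2 ?_, WithTop.coe_le_coe.2 ?_⟩ <;> linarith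
  · rintro ⟨b, e⟩ hp hD
    obtain ⟨e, rfl, he⟩ := exists_coe_of_mem_birthDeathBox hp
    have hb := hp.1
    obtain ⟨i₁, j₁, rfl⟩ := exists_eq_snd_of_dgm_ne_zero hD
    obtain ⟨i₂, j₂, h₂⟩ := exists_eq_fst_of_dgm_ne_zero hD
    simp only at h₂ hb
    subst h₂
    rw [eq_of_abs_sub_lt hgap (i := i₁) (i' := i') (j' := j'),
      eq_of_abs_sub_lt hgap (i := i₂) (i' := i) (j' := j), Finset.mem_singleton] <;>
    rw [abs_lt] <;> constructor <;> linarith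

/-- Under a small perturbation of the dissimilarity, every point of the diagram can be followed,
and the other points of the new diagram are close to the diagonal. -/
theorem exists_injective_dgm [Finite ι] [Nonempty ι] (hd : ∀ i, d i i = 0) (hd' : ∀ i, d' i i = 0)
    (hδ : 0 < δ) (hgap : ∀ i j i' j', d i j ≠ d i' j' → 10 * δ ≤ |d i j - d i' j'|)
    (hclose : ∀ i j, |d' i j - d i j| ≤ δ) :
    ∃ j : OffDiagonalPoint (dgm F d k) → OffDiagonalPoint (dgm F d' k), Function.Injective j ∧
      (∀ α, pairDist α.1 (j α).1 ≤ ENNReal.ofReal (2 * δ)) ∧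
      ∀ z, z ∉ Set.range j →
        ∃ y : ℝ, pairDist z.1 (y, (y : WithTop ℝ)) ≤ ENNReal.ofReal (2 * δ) := by
  classical
  have hcard : ∀ p, dgm F d k p ≠ 0 →
      Nat.card {z : OffDiagonalPoint (dgm F d' k) // z.1 ∈ birthDeathNhd (2 * δ) p} =
        dgm F d k p := by
    rintro ⟨b, e⟩ hp
    induction e with
    | top =>
      rw [PersistenceDiagram.card_offDiagonalPoint (T := {(b, ⊤)}), Finset.sum_singleton,
        dgm_top hd, dgm_top hd']
      · intro p hp
        exact Finset.mem_singleton.1 hp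
      · intro p hp _
        exact Finset.mem_singleton.2 hp
    | coe e =>
      obtain ⟨i', j', rfl⟩ := exists_eq_snd_of_dgm_ne_zero hp
      obtain ⟨i, j, h⟩ := exists_eq_fst_of_dgm_ne_zero hp
      simp only at h
      subst h
      exact card_birthDeathNhd hδ hgap hclose
        (WithTop.coe_lt_coe.1 (fst_lt_snd_of_dgm_ne_zero hp))
  -- A common element puts the two points within `4 * δ` of each other, less than the gap between
  -- distinct values.
  have hdisj : ∀ p p', dgm F d k p ≠ 0 → dgm F d k p' ≠ 0 → ∀ z, z ∈ birthDeathNhd (2 * δ) p →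
      z ∈ birthDeathNhd (2 * δ) p' → p = p' := by
    rintro ⟨b, e⟩ ⟨b', e'⟩ hp hp' z hz hz'
    have h₂ := pairDist_le_of_mem_birthDeathNhd (by linarith) hz
    have h₃ := pairDist_le_of_mem_birthDeathNhd (by linarith) hz'
    rw [pairDist_comm] at h₃
    have h := ((pairDist_triangle _ z _).trans (add_le_add h₂ h₃)).trans_eq
      (ENNReal.ofReal_add (by linarith) (by linarith)).symm
    obtain ⟨i, j, hb⟩ := exists_eq_fst_of_dgm_ne_zero hp
    obtain ⟨i', j', hb'⟩ := exists_eq_fst_of_dgm_ne_zero hp'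
    have h₁ := (le_max_left _ _).trans h
    rw [ENNReal.ofReal_le_ofReal_iff (by linarith)] at h₁
    simp only at hb hb' h₁
    subst hb hb'
    rw [eq_of_abs_sub_lt hgap (h₁.trans_lt (by linarith))]
    induction e with
    | top =>
      have := (pairDist_ne_top_iff.1 (h.trans_lt ENNReal.ofReal_lt_top).ne).1 rfl
      simp only at this
      rw [this]
    | coe e =>
      obtain ⟨e', rfl⟩ := WithTop.ne_top_iff_exists.1 fun h' => WithTop.coe_ne_top
        ((pairDist_ne_top_iff.1 (h.trans_lt ENNReal.ofReal_lt_top).ne).2 h')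
      obtain ⟨i₁, j₁, rfl⟩ := exists_eq_snd_of_dgm_ne_zero hp
      obtain ⟨i₁', j₁', rfl⟩ := exists_eq_snd_of_dgm_ne_zero hp'
      rw [eq_of_abs_sub_lt hgap
        (((pairDist_coe_le_of_nonneg (by linarith)).1 h).2.trans_lt (by linarith))]
  obtain ⟨j, hj, hmem, hrange⟩ := PersistenceDiagram.exists_injective_of_card_eq hcard hdisj
  refine ⟨j, hj, fun α => pairDist_le_of_mem_birthDeathNhd (by linarith) (hmem α), ?_⟩
  rintro ⟨⟨b, e⟩, n⟩ hz
  have hne : dgm F d' k (b, e) ≠ 0 := Nat.pos_iff_ne_zero.1 n.pos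
  induction e with
  | top =>
    refine absurd (hrange ⟨(b, ⊤), n⟩ (b, ⊤) ?_ rfl) hz
    rwa [dgm_top hd, ← dgm_top hd' (F := F)]
  | coe e =>
    have hbe : b < e := WithTop.coe_lt_coe.1 (fst_lt_snd_of_dgm_ne_zero hne)
    obtain ⟨i, j, hb⟩ := exists_eq_fst_of_dgm_ne_zero hne
    obtain ⟨i', j', he⟩ := exists_eq_snd_of_dgm_ne_zero hne
    simp only at hb
    have h₁ := abs_le.1 (hclose i j)
    have h₂ := abs_le.1 (hclose i' j')
    refine ⟨_, pairDist_midpoint_le hbe.le ?_⟩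
    -- A lifespan above `4 * δ` survives rounding birth and death to the old distances. The box
    -- around the rounded pair then contains a new point, so the rounded pair is an old point and
    -- the new one has been accounted for.
    by_contra! hlt
    have hmem' : (b, (e : WithTop ℝ)) ∈ birthDeathNhd (2 * δ) (d i j, (d i' j' : WithTop ℝ)) := by
      refine ⟨⟨?_, ?_⟩, WithTop.coe_lt_coe.2 ?_, WithTop.coe_le_coe.2 ?_⟩ <;> linarith
    refine hz (hrange ⟨(b, (e : WithTop ℝ)), n⟩ _ ?_ hmem')
    rw [← card_birthDeathNhd (F := F) (k := k) hδ hgap hclose (by linarith)]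
    have := finite_offDiagonalPoint_dgm F d' k
    exact Nat.card_ne_zero.2 ⟨⟨⟨⟨(b, (e : WithTop ℝ)), n⟩, hmem'⟩⟩, inferInstance⟩

/-! ### Essential classes and finiteness of the distance -/

theorem eq_of_snd_eq_top [Finite ι] [Nonempty ι] (hd : ∀ i, d i i = 0)
    {α α' : OffDiagonalPoint (dgm F d k)} (h : α.1.2 = ⊤) (h' : α'.1.2 = ⊤) : α = α' := by
  classical
  obtain ⟨⟨b, e⟩, n⟩ := α
  obtain ⟨⟨b', e'⟩, n'⟩ := α'
  simp only at h h'
  subst h h'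
  have hn := n.2.trans_eq (dgm_top hd k b)
  have hn' := n'.2.trans_eq (dgm_top hd k b')
  have hb : b = 0 := by
    by_contra hb
    simp [hb] at hn
  have hb' : b' = 0 := by
    by_contra hb'
    simp [hb'] at hn'
  subst hb hb'
  have : (n : ℕ) = n' := by split_ifs at hn hn' <;> omega
  rw [Fin.ext this]

theorem exists_snd_eq_top {ι' : Type v} [Finite ι] [Nonempty ι] [Finite ι'] [Nonempty ι']
    (hd : ∀ i, d i i = 0) {d' : ι' → ι' → ℝ} (hd' : ∀ i, d' i i = 0)
    {α : OffDiagonalPoint (dgm F d k)} (h : α.1.2 = ⊤) :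
    ∃ β : OffDiagonalPoint (dgm F d' k), β.1.2 = ⊤ := by
  obtain ⟨⟨b, e⟩, n⟩ := α
  simp only at h
  subst h
  exact ⟨⟨(b, ⊤), n.cast (by rw [dgm_top hd, dgm_top hd'])⟩, rfl⟩

/-- A pair has infinite cost when exactly one of its deaths is infinite. The two diagrams have the
same number of essential points, at most one each, so a mismatch at `(a, q)` leaves an essential
point of the other diagram mismatched as well. This contradicts the uniqueness of the pair. -/
theorem bottleneckDist_ne_top_of_realizes {ι' : Type v} [Finite ι] [Nonempty ι] [Finite ι']
    [Nonempty ι'] (hd : ∀ i, d i i = 0) {d' : ι' → ι' → ℝ} (hd' : ∀ i, d' i i = 0)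
    {a : OffDiagonalPoint (dgm F d k)} {q : DiagramPoint (dgm F d' k)}
    (h : RealizesBottleneck a q) : bottleneckDist (dgm F d k) (dgm F d' k) ≠ ⊤ := by
  intro htop
  obtain ⟨Ω, hΩ, -, ha, huniq⟩ := h
  rw [htop] at huniq
  have hcost : ¬(a.1.2 = ⊤ ↔ q.coords.2 = ⊤) := fun h' =>
    pairDist_ne_top_iff.2 h' ((huniq _ ha).2 rfl)
  have hother : ∀ m ∈ Ω, m ≠ (Sum.inl a, q) → (m.1.coords.2 = ⊤ ↔ m.2.coords.2 = ⊤) :=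
    fun m hm hne => pairDist_ne_top_iff.1 fun h' => hne ((huniq m hm).1 h')
  by_cases hae : a.1.2 = ⊤
  · obtain ⟨β, hβ⟩ := exists_snd_eq_top (F := F) hd hd' hae
    obtain ⟨p, hp, -⟩ := hΩ.right β
    have hne : (p, Sum.inl β) ≠ (Sum.inl a, q) := by
      intro h'
      obtain ⟨rfl, rfl⟩ := Prod.mk.inj h'
      exact hcost (iff_of_true hae hβ)
    have hp' := (hother _ hp hne).2 hβ
    rcases p with α | x
    · obtain rfl := eq_of_snd_eq_top hd hp' hae
      exact hne (Prod.ext rfl ((hΩ.left α).unique hp ha))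
    · exact WithTop.coe_ne_top hp'
  · have hq : q.coords.2 = ⊤ := by
      by_contra hq
      exact hcost (iff_of_false hae hq)
    rcases q with β | x
    · obtain ⟨α, hα⟩ := exists_snd_eq_top (F := F) hd' hd hq
      obtain ⟨q', hq', -⟩ := hΩ.left α
      have hne : α ≠ a := fun h' => hae (h' ▸ hα)
      have hq'' := (hother _ hq' fun h' => hne (Sum.inl_injective (Prod.mk.inj h').1)).1 hα
      rcases q' with β' | x
      · obtain rfl := eq_of_snd_eq_top hd' hq'' hq
        exact hne (Sum.inl_injective ((hΩ.right β').unique hq' ha))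
      · exact WithTop.coe_ne_top hq''
    · exact WithTop.coe_ne_top hq

end VietorisRips

/-! ### The margin of the other pairs -/

theorem IsMatching.finite {D₁ D₂ : PersistenceDiagram} [Finite (OffDiagonalPoint D₁)]
    [Finite (OffDiagonalPoint D₂)] {Ω : Set (DiagramPoint D₁ × DiagramPoint D₂)}
    (hΩ : IsMatching Ω) : Ω.Finite := by
  refine (Set.finite_range (Sum.elim
    (fun α : OffDiagonalPoint D₁ => ((Sum.inl α, (hΩ.left α).choose) :
      DiagramPoint D₁ × DiagramPoint D₂))
    (fun β : OffDiagonalPoint D₂ => ((hΩ.right β).choose, Sum.inl β)))).subset ?_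
  rintro ⟨α | x, β | y⟩ hm
  · exact ⟨Sum.inl α, Prod.ext rfl ((hΩ.left α).choose_spec.2 _ hm).symm⟩
  · exact ⟨Sum.inl α, Prod.ext rfl ((hΩ.left α).choose_spec.2 _ hm).symm⟩
  · exact ⟨Sum.inr β, Prod.ext ((hΩ.right β).choose_spec.2 _ hm).symm rfl⟩
  · exact absurd hm (hΩ.not_diagonal x y)

/-- The pairs which do not realize the bottleneck distance stay away from it. -/
theorem RealizesBottleneck.exists_margin {D₁ D₂ : PersistenceDiagram}
    [Finite (OffDiagonalPoint D₁)] [Finite (OffDiagonalPoint D₂)] {a : OffDiagonalPoint D₁}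
    {q : DiagramPoint D₂} (h : RealizesBottleneck a q) {D : ℝ} (hD : 0 < D)
    (hDeq : bottleneckDist D₁ D₂ = ENNReal.ofReal D) :
    ∃ Ω : Set (DiagramPoint D₁ × DiagramPoint D₂), IsMatching Ω ∧ (Sum.inl a, q) ∈ Ω ∧
      matchCost (Sum.inl a, q) = ENNReal.ofReal D ∧ ∃ η : ℝ, 0 < η ∧ η ≤ D ∧
      ∀ m ∈ Ω, m ≠ (Sum.inl a, q) → matchCost m ≤ ENNReal.ofReal (D - η) := by
  obtain ⟨Ω, hΩ, hcost, ha, huniq⟩ := h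
  rw [hDeq] at hcost huniq
  refine ⟨Ω, hΩ, ha, (huniq _ ha).2 rfl, ?_⟩
  -- The finitely many other pairs. If there are none, the supremum below is 0 and the margin is all
  -- of `D`.
  let S := (hΩ.finite.subset (Set.sdiff_subset (t := {(Sum.inl a, q)}))).toFinset
  have hS : S.sup matchCost < ENNReal.ofReal D := by
    refine (Finset.sup_lt_iff (ENNReal.ofReal_pos.2 hD)).2 fun m hm => ?_
    obtain ⟨hm, hne⟩ := (Set.Finite.mem_toFinset _).1 hm
    exact lt_of_le_of_ne ((le_iSup₂ (f := fun m _ => matchCost m) m hm).trans_eq hcost)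
      fun h' => hne ((huniq m hm).1 h')
  have hr := (ENNReal.lt_ofReal_iff_toReal_lt hS.ne_top).1 hS
  refine ⟨D - (S.sup matchCost).toReal, sub_pos.2 hr, sub_le_self _ ENNReal.toReal_nonneg,
    fun m hm hne => ?_⟩
  rw [sub_sub_cancel, ENNReal.ofReal_toReal hS.ne_top]
  exact Finset.le_sup ((Set.Finite.mem_toFinset _).2 ⟨hm, hne⟩)

/-! ### Rates and directions of motion -/

theorem eventually_mul_le_nhdsGT_zero (c : ℝ) {x : ℝ} (hx : 0 < x) :
    ∀ᶠ t : ℝ in 𝓝[>] 0, c * t ≤ x := by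
  have h : Tendsto (fun t : ℝ => c * t) (𝓝 0) (𝓝 0) :=
    (continuous_const.mul continuous_id).tendsto' 0 0 (mul_zero c)
  exact (h.eventually_le_const hx).filter_mono nhdsWithin_le_nhds

/-- Move `u` towards `u'` at unit speed, or keep it fixed if it is already there. -/
theorem exists_rate {u u' D : ℝ} (hD : 0 < D) (h : |u - u'| ≤ D) :
    ∃ α : ℝ, (u = u' → α = 0) ∧ ∀ᶠ t : ℝ in 𝓝[>] 0, |u + α * t - u'| ≤ D - t := by
  rcases lt_trichotomy u u' with hu | rfl | hu
  · refine ⟨1, fun h' => absurd h' hu.ne, ?_⟩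
    filter_upwards [eventually_mul_le_nhdsGT_zero 1 (sub_pos.2 hu)] with t ht
    rw [abs_of_neg (sub_neg.2 hu)] at h
    rw [abs_of_nonpos (by linarith)]
    linarith
  · refine ⟨0, fun _ => rfl, ?_⟩
    filter_upwards [eventually_mul_le_nhdsGT_zero 1 hD] with t ht
    rw [zero_mul, add_zero, sub_self, abs_zero]
    linarith
  · refine ⟨-1, fun h' => absurd h' hu.ne', ?_⟩
    filter_upwards [eventually_mul_le_nhdsGT_zero 1 (sub_pos.2 hu)] with t ht
    rw [abs_of_pos (sub_pos.2 hu)] at h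
    rw [abs_of_nonneg (by linarith)]
    linarith

section Direction

variable {E : Type v} [NormedAddCommGroup E] [NormedSpace ℝ E] {κ : Type w}

theorem dist_add_smul_sub {x y : E} {r α t : ℝ} (hr : 0 < r) (h : dist x y = r)
    (ht : 0 ≤ r + α * t) : dist (x + t • (α / r) • (x - y)) y = r + α * t := by
  have : x + t • (α / r) • (x - y) - y = (1 + t * (α / r)) • (x - y) := by
    rw [add_smul, one_smul, mul_smul]
    abel
  rw [dist_eq_norm, this, norm_smul, ← dist_eq_norm, h, Real.norm_eq_abs]
  nth_rw 2 [← abs_of_pos hr]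
  rw [← abs_mul, ← abs_of_nonneg ht]
  congr 1
  field_simp

/-- Moving one endpoint of a pair along the line through both makes their distance affine in `t`.
The point is to choose the moved endpoints so that the `b`-pair and the `e`-pair do not interfere.
-/
theorem exists_direction (Y : κ → E) {b e : ℝ} (hb : ∃ i j, dist (Y i) (Y j) = b)
    (he : ∃ i j, dist (Y i) (Y j) = e) (hbe : b < e)
    (hgb : 0 < b → ∀ i j i' j', dist (Y i) (Y j) = b → dist (Y i') (Y j') = b →
      s(i, j) = s(i', j'))
    (hge : ∀ i j i' j', dist (Y i) (Y j) = e → dist (Y i') (Y j') = e → s(i, j) = s(i', j'))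
    (α β : ℝ) (hβ : b = 0 → β = 0) :
    ∃ v : κ → E, ∀ᶠ t : ℝ in 𝓝[>] 0,
      (∀ i j, dist (Y i) (Y j) = b → dist ((Y + t • v) i) ((Y + t • v) j) = b + β * t) ∧
      ∀ i j, dist (Y i) (Y j) = e → dist ((Y + t • v) i) ((Y + t • v) j) = e + α * t := by
  classical
  obtain ⟨i, j, hij⟩ := hb
  obtain ⟨k, l, hkl⟩ := he
  have hb0 : 0 ≤ b := hij ▸ dist_nonneg
  have he0 : 0 < e := hb0.trans_lt hbe
  have hkl' : k ≠ l := by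
    rintro rfl
    rw [dist_self] at hkl
    exact he0.ne hkl
  have hte := eventually_mul_le_nhdsGT_zero (-α) he0
  rcases hb0.eq_or_lt with rfl | hb0
  · refine ⟨Pi.single k ((α / e) • (Y k - Y l)), ?_⟩
    filter_upwards [hte] with t ht
    -- Moving `Y k` must not separate coincident points: an index `m` with `Y m = Y k` would give a
    -- second pair at distance `e`.
    have hk : ∀ m, dist (Y k) (Y m) = 0 → m = k := by
      intro m hm
      have h := hge k l m l hkl (by rw [← dist_eq_zero.1 hm, hkl])
      exact (Sym2.congr_left.1 h).symm
    have hYk : (Y + t • (Pi.single k ((α / e) • (Y k - Y l)) : κ → E)) k =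
        Y k + t • (α / e) • (Y k - Y l) := by
      simp
    have hY : ∀ m, m ≠ k → (Y + t • (Pi.single k ((α / e) • (Y k - Y l)) : κ → E)) m = Y m := by
      intro m hm
      simp [hm]
    have hmove := dist_add_smul_sub (α := α) (t := t) he0 hkl (by linarith)
    refine ⟨fun i' j' h => ?_, fun i' j' h => ?_⟩
    · rw [hβ rfl, zero_mul, add_zero]
      by_cases hi : i' = k
      · subst hi
        rw [hk j' h, dist_self]
      · by_cases hj : j' = k
        · subst hj
          rw [hk i' (by rwa [dist_comm]), dist_self]
        · rw [hY i' hi, hY j' hj, h]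
    · rcases Sym2.eq_iff.1 (hge i' j' k l h hkl) with ⟨rfl, rfl⟩ | ⟨rfl, rfl⟩
      · rw [hYk, hY _ hkl'.symm, hmove]
      · rw [hYk, hY _ hkl'.symm, dist_comm, hmove]
  · have htb := eventually_mul_le_nhdsGT_zero (-β) hb0
    have hij' : i ≠ j := by
      rintro rfl
      rw [dist_self] at hij
      exact hb0.ne hij
    have hne : s(i, j) ≠ s(k, l) := by
      intro h
      rcases Sym2.eq_iff.1 h with ⟨rfl, rfl⟩ | ⟨rfl, rfl⟩
      · exact hbe.ne (hij.symm.trans hkl)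
      · exact hbe.ne (hij.symm.trans ((dist_comm _ _).trans hkl))
    -- Two distinct unordered pairs: each has an endpoint outside the other, and those endpoints are
    -- moved.
    have hexists : ∃ i₁ j₁, s(i, j) = s(i₁, j₁) ∧ i₁ ≠ k ∧ i₁ ≠ l := by
      by_cases hi : i ≠ k ∧ i ≠ l
      · exact ⟨i, j, rfl, hi⟩
      · refine ⟨j, i, Sym2.eq_swap, ?_⟩
        grind
    have hexists' : ∃ k₁ l₁, s(k, l) = s(k₁, l₁) ∧ k₁ ≠ i ∧ k₁ ≠ j := by
      by_cases hk : k ≠ i ∧ k ≠ j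
      · exact ⟨k, l, rfl, hk⟩
      · refine ⟨l, k, Sym2.eq_swap, ?_⟩
        grind
    obtain ⟨i₁, j₁, hs, hi₁⟩ := hexists
    obtain ⟨k₁, l₁, hs', hk₁⟩ := hexists'
    have hij₁ : dist (Y i₁) (Y j₁) = b := by
      rcases Sym2.eq_iff.1 hs with ⟨rfl, rfl⟩ | ⟨rfl, rfl⟩
      · exact hij
      · rwa [dist_comm]
    have hkl₁ : dist (Y k₁) (Y l₁) = e := by
      rcases Sym2.eq_iff.1 hs' with ⟨rfl, rfl⟩ | ⟨rfl, rfl⟩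
      · exact hkl
      · rwa [dist_comm]
    have hdist : i₁ ≠ k₁ ∧ i₁ ≠ l₁ ∧ j₁ ≠ k₁ ∧ i₁ ≠ j₁ ∧ k₁ ≠ l₁ := by
      rcases Sym2.eq_iff.1 hs with ⟨rfl, rfl⟩ | ⟨rfl, rfl⟩ <;>
      rcases Sym2.eq_iff.1 hs' with ⟨rfl, rfl⟩ | ⟨rfl, rfl⟩ <;> grind
    obtain ⟨h₁, h₂, h₃, h₄, h₅⟩ := hdist
    let v : κ → E := Pi.single k₁ ((α / e) • (Y k₁ - Y l₁)) +
      Pi.single i₁ ((β / b) • (Y i₁ - Y j₁))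
    refine ⟨v, ?_⟩
    filter_upwards [hte, htb] with t hte htb
    have hvk : (Y + t • v) k₁ = Y k₁ + t • (α / e) • (Y k₁ - Y l₁) := by
      simp [v, h₁.symm]
    have hvi : (Y + t • v) i₁ = Y i₁ + t • (β / b) • (Y i₁ - Y j₁) := by
      simp [v, h₁]
    have hvl : (Y + t • v) l₁ = Y l₁ := by
      simp [v, h₅.symm, h₂.symm]
    have hvj : (Y + t • v) j₁ = Y j₁ := by
      simp [v, h₃, h₄.symm]
    have hme := dist_add_smul_sub (α := α) (t := t) he0 hkl₁ (by linarith)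
    have hmb := dist_add_smul_sub (α := β) (t := t) hb0 hij₁ (by linarith)
    refine ⟨fun i' j' h => ?_, fun i' j' h => ?_⟩
    · rcases Sym2.eq_iff.1 (hgb hb0 i' j' i₁ j₁ h hij₁) with ⟨rfl, rfl⟩ | ⟨rfl, rfl⟩
      · rw [hvi, hvj, hmb]
      · rw [hvi, hvj, dist_comm, hmb]
    · rcases Sym2.eq_iff.1 (hge i' j' k₁ l₁ h hkl₁) with ⟨rfl, rfl⟩ | ⟨rfl, rfl⟩
      · rw [hvk, hvl, hme]
      · rw [hvk, hvl, dist_comm, hme]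

end Direction

/-- Rates of change of the birth and of the death of a point which decrease the cost of its pair in
a matching. -/
theorem exists_rates {D₁ D₂ : PersistenceDiagram} {a : OffDiagonalPoint D₁} {q : DiagramPoint D₂}
    {b e D : ℝ} (ha : a.1 = (b, (e : WithTop ℝ))) (hbe : b < e) (hD : 0 < D)
    (hcost : matchCost (Sum.inl a, q) = ENNReal.ofReal D)
    (hb : b = 0 → ∀ β, q = Sum.inl β → β.1.1 = 0) :
    ∃ α β c : ℝ, 0 < c ∧ (b = 0 → β = 0) ∧ ∀ᶠ t : ℝ in 𝓝[>] 0,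
      (∀ β', q = Sum.inl β' →
        pairDist (b + β * t, ((e + α * t : ℝ) : WithTop ℝ)) β'.1 ≤ ENNReal.ofReal (D - c * t)) ∧
      ∀ x : ℝ, q = Sum.inr x → ∃ y : ℝ,
        pairDist (b + β * t, ((e + α * t : ℝ) : WithTop ℝ)) (y, (y : WithTop ℝ)) ≤
          ENNReal.ofReal (D - c * t) := by
  have hcost' : pairDist a.1 q.coords = ENNReal.ofReal D := hcost
  rw [ha] at hcost'
  rcases q with ⟨⟨b', e'⟩, n⟩ | x
  · obtain ⟨e', rfl⟩ : ∃ e'' : ℝ, e' = e'' :=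
      exists_coe_of_pairDist_ne_top (hcost'.trans_lt ENNReal.ofReal_lt_top).ne
    obtain ⟨h₁, h₂⟩ := (pairDist_coe_le_of_nonneg hD.le).1 hcost'.le
    obtain ⟨β, hβ, hβt⟩ := exists_rate hD h₁
    obtain ⟨α, -, hαt⟩ := exists_rate hD h₂
    refine ⟨α, β, 1, one_pos, fun h => hβ (h.trans (hb h _ rfl).symm), ?_⟩
    filter_upwards [hβt, hαt, eventually_mul_le_nhdsGT_zero 1 hD] with t h₁ h₂ h₃
    refine ⟨fun β' h => ?_, fun x h => by simp at h⟩
    obtain rfl := Sum.inl_injective h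
    rw [one_mul] at h₃ ⊢
    exact (pairDist_coe_le_of_nonneg (sub_nonneg.2 h₃)).2 ⟨h₁, h₂⟩
  · have h := sub_le_of_pairDist_diagonal_le hD.le hcost'.le
    -- The distance to the diagonal is half the lifespan, so lowering the death at unit speed gains
    -- at rate `1 / 2`; the birth stays fixed.
    refine ⟨-1, 0, 1 / 2, by norm_num, fun _ => rfl, ?_⟩
    filter_upwards [eventually_mul_le_nhdsGT_zero 1 (sub_pos.2 hbe)] with t ht
    exact ⟨fun β' h => by simp at h,
      fun _ _ => ⟨_, pairDist_midpoint_le (by linarith) (by linarith)⟩⟩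

theorem eventually_abs_dist_sub_le {κ : Type w} [Finite κ] {E : Type v} [NormedAddCommGroup E]
    [NormedSpace ℝ E] (Y v : κ → E) {δ : ℝ} (hδ : 0 < δ) :
    ∀ᶠ t : ℝ in 𝓝[>] 0, ∀ i j,
      |cloudDist (Y + t • v) i j - cloudDist Y i j| ≤ δ := by
  refine eventually_all.2 fun i => eventually_all.2 fun j => ?_
  have h : Continuous fun t : ℝ => |cloudDist (Y + t • v) i j - cloudDist Y i j| := by
    simp only [cloudDist, Pi.add_apply, Pi.smul_apply]
    fun_prop
  exact ((h.tendsto' 0 0 (by simp)).eventually_le_const hδ).filter_mono nhdsWithin_le_nhds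

theorem eventually_gap {ι : Type w} [Finite ι] (d : ι → ι → ℝ) :
    ∀ᶠ δ : ℝ in 𝓝[>] 0, ∀ i j i' j', d i j ≠ d i' j' → 10 * δ ≤ |d i j - d i' j'| := by
  simp only [eventually_all]
  exact fun i j i' j' h => eventually_mul_le_nhdsGT_zero 10 (abs_pos.2 (sub_ne_zero.2 h))

/-- A point of the diagram keeps its exact birth and death values if all the distances realizing
them are known. -/
theorem VietorisRips.eq_of_pairDist_le {F : Type u} [Field F] {ι : Type w} [Finite ι] {k : ℕ}
    {d d' : ι → ι → ℝ} {δ b e b' e' : ℝ} (hδ : 0 < δ)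
    (hgap : ∀ i j i' j', d i j ≠ d i' j' → 10 * δ ≤ |d i j - d i' j'|)
    (hclose : ∀ i j, |d' i j - d i j| ≤ δ) (hb : ∃ i j, d i j = b) (he : ∃ i j, d i j = e)
    (hb' : ∀ i j, d i j = b → d' i j = b') (he' : ∀ i j, d i j = e → d' i j = e')
    {z : OffDiagonalPoint (dgm F d' k)}
    (hz : pairDist (b, (e : WithTop ℝ)) z.1 ≤ ENNReal.ofReal (2 * δ)) :
    z.1 = (b', (e' : WithTop ℝ)) := by
  obtain ⟨⟨x, y⟩, n⟩ := z
  have hne : dgm F d' k (x, y) ≠ 0 := Nat.pos_iff_ne_zero.1 n.pos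
  obtain ⟨y, rfl⟩ : ∃ y' : ℝ, y = y' :=
    exists_coe_of_pairDist_ne_top (hz.trans_lt ENNReal.ofReal_lt_top).ne
  obtain ⟨h₁, h₂⟩ := (pairDist_coe_le_of_nonneg (by linarith)).1 hz
  obtain ⟨i, j, hx⟩ := exists_eq_fst_of_dgm_ne_zero hne
  obtain ⟨i', j', hy⟩ := exists_eq_snd_of_dgm_ne_zero hne
  obtain ⟨i₁, j₁, rfl⟩ := hb
  obtain ⟨i₂, j₂, rfl⟩ := he
  simp only at hx
  rw [abs_le] at h₁ h₂
  have hij := abs_le.1 (hclose i j)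
  have hij' := abs_le.1 (hclose i' j')
  -- The birth `x` is a new distance `d' i j` whose old value lies within `3 * δ` of `b`, hence
  -- equals `b`; likewise for the death.
  change (x, (y : WithTop ℝ)) = _
  rw [← hx, ← hy, hb' i j, he' i' j']
  · exact eq_of_abs_sub_lt hgap (by rw [abs_lt]; constructor <;> linarith)
  · exact eq_of_abs_sub_lt hgap (by rw [abs_lt]; constructor <;> linarith)

/-! ### The descent direction -/

theorem theorem1 {F : Type*} [Field F] (k : ℕ)
    {ι : Type*} [Finite ι] [Nonempty ι] (dX : ι → ι → ℝ)
    (hdX_nonneg : ∀ i j, 0 ≤ dX i j) (hdX_self : ∀ i, dX i i = 0)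
    {E : Type*} [NormedAddCommGroup E] [NormedSpace ℝ E]
    (hE : ∀ x : E, x ≠ 0 → DifferentiableAt ℝ (fun z : E => ‖z‖) x)
    {κ : Type*} [Finite κ] (Y : κ → E)
    (hpos : 0 < bottleneckDist (VietorisRips.dgm F (cloudDist Y) k) (VietorisRips.dgm F dX k))
    (a : OffDiagonalPoint (VietorisRips.dgm F (cloudDist Y) k))
    (q : DiagramPoint (VietorisRips.dgm F dX k))
    (hreal : RealizesBottleneck a q)
    (hgen : ∀ r : ℝ, 0 < r → (r = a.1.1 ∨ (r : WithTop ℝ) = a.1.2) →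
      ∀ i j i' j' : κ, dist (Y i) (Y j) = r → dist (Y i') (Y j') = r → s(i, j) = s(i', j')) :
    ∃ v : κ → E, IsDescentDirection
      (fun Z : κ → E =>
        bottleneckDist (VietorisRips.dgm F (cloudDist Z) k) (VietorisRips.dgm F dX k)) Y v := by
  have hself : ∀ (Z : κ → E) i, cloudDist Z i i = 0 := fun Z i => dist_self _
  have hane : VietorisRips.dgm F (cloudDist Y) k a.1 ≠ 0 := Nat.pos_iff_ne_zero.1 a.2.pos
  have hbval := VietorisRips.exists_eq_fst_of_dgm_ne_zero hane
  have : Nonempty κ := ⟨hbval.choose⟩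
  have hfin := VietorisRips.bottleneckDist_ne_top_of_realizes (hself Y) hdX_self hreal
  obtain ⟨D, hDeq⟩ : ∃ D : ℝ,
      bottleneckDist (VietorisRips.dgm F (cloudDist Y) k) (VietorisRips.dgm F dX k) =
        ENNReal.ofReal D := ⟨_, (ENNReal.ofReal_toReal hfin).symm⟩
  have hD : 0 < D := ENNReal.ofReal_pos.1 (hDeq ▸ hpos)
  have := VietorisRips.finite_offDiagonalPoint_dgm F (cloudDist Y) k
  have := VietorisRips.finite_offDiagonalPoint_dgm F dX k
  obtain ⟨Ω, hΩ, ha, hcost, η, hη, hηD, hother⟩ := hreal.exists_margin hD hDeq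
  obtain ⟨b, hb⟩ : ∃ b, b = a.1.1 := ⟨_, rfl⟩
  have hb0 : 0 ≤ b := by
    obtain ⟨i, j, h⟩ := hbval
    rw [hb, ← h]
    exact dist_nonneg
  -- In degree 0 all births are 0; in positive degree a point cloud has no births at 0.
  have hbq : b = 0 → ∀ β, q = Sum.inl β → β.1.1 = 0 := by
    intro h0 β _
    have hβ : VietorisRips.dgm F dX k β.1 ≠ 0 := Nat.pos_iff_ne_zero.1 β.2.pos
    rcases k with _ | k
    · exact VietorisRips.fst_eq_zero_of_dgm_zero_ne_zero hdX_self hβ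
    · exact absurd (hb.symm.trans h0)
        (VietorisRips.fst_ne_zero_of_dgm_cloudDist_succ_ne_zero hane)
  -- An essential `a` is born at 0, and its partner, being at finite distance, is essential and born
  -- at 0 too. The cost would be 0, against `D > 0`.
  have hatop : a.1.2 ≠ ⊤ := by
    intro htop
    have hqtop : q.coords.2 = ⊤ := (pairDist_ne_top_iff.1
      (hcost.trans_lt ENNReal.ofReal_lt_top).ne).1 htop
    rcases q with β | x
    · have hβ : VietorisRips.dgm F dX k β.1 ≠ 0 := Nat.pos_iff_ne_zero.1 β.2.pos
      have hb₀ : b = 0 := by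
        classical
        have h := VietorisRips.dgm_top (F := F) (hself Y) k b
        have h' : (b, ⊤) = a.1 := Prod.ext hb htop.symm
        rw [h'] at h
        by_contra hb₀
        exact hane (h.trans (if_neg fun h'' => hb₀ h''.2))
      have hβ₀ := hbq hb₀ β rfl
      have : a.1 = β.1 := Prod.ext ((hb.symm.trans hb₀).trans hβ₀.symm) (htop.trans hqtop.symm)
      have h0 : pairDist a.1 β.1 = 0 := by
        rw [this, show β.1 = (β.1.1, ⊤) from Prod.ext rfl hqtop]
        refine le_antisymm (max_le ?_ le_rfl) zero_le
        simp
      exact (ENNReal.ofReal_pos.2 hD).ne (h0.symm.trans hcost)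
    · exact WithTop.coe_ne_top hqtop
  obtain ⟨e, he⟩ := WithTop.ne_top_iff_exists.1 hatop
  have hae : a.1 = (b, (e : WithTop ℝ)) := Prod.ext hb.symm he.symm
  rw [hae] at hane
  have hbe : b < e := WithTop.coe_lt_coe.1 (VietorisRips.fst_lt_snd_of_dgm_ne_zero hane)
  have hbval := VietorisRips.exists_eq_fst_of_dgm_ne_zero hane
  have heval := VietorisRips.exists_eq_snd_of_dgm_ne_zero hane
  obtain ⟨α, β, c, hc, hβ, hrates⟩ := exists_rates hae hbe hD hcost hbq
  obtain ⟨v, hv⟩ := exists_direction Y hbval heval hbe (fun h => hgen b h (Or.inl hb))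
    (hgen e (hb0.trans_lt hbe) (Or.inr he)) α β hβ
  refine ⟨v, hfin, c, hc, ?_⟩
  -- `δ` is fixed before `t`. With `4 * δ ≤ η` and `c * t ≤ η / 2`, a pair of cost at most `D - η`
  -- displaced by `2 * δ` still costs at most `D - c * t`; the new points near the diagonal fit too,
  -- as `η ≤ D`.
  obtain ⟨δ, hgap, hδη, hδ⟩ := ((eventually_gap (cloudDist Y)).and
    ((eventually_mul_le_nhdsGT_zero 4 hη).and self_mem_nhdsWithin)).exists
  have hδ : 0 < δ := hδ
  filter_upwards [hrates, hv, eventually_abs_dist_sub_le Y v hδ,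
    eventually_mul_le_nhdsGT_zero c (half_pos hη), self_mem_nhdsWithin] with t hr hvt hclose hct ht
  have ht : 0 < t := ht
  have hct0 : 0 < c * t := mul_pos hc ht
  obtain ⟨j, hj, hjclose, hjrange⟩ := VietorisRips.exists_injective_dgm (F := F) (k := k)
    (hself Y) (hself (Y + t • v)) hδ hgap hclose
  -- An error of `2 * δ` would spoil the gain at the critical pair, so the exact position of the
  -- followed point is needed.
  have hja : (j a).1 = (b + β * t, ((e + α * t : ℝ) : WithTop ℝ)) :=
    VietorisRips.eq_of_pairDist_le hδ hgap hclose hbval heval hvt.1 hvt.2 (hae ▸ hjclose a)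
  have hmove : ∀ α' q', (Sum.inl α', q') ∈ Ω →
      (Sum.inl α', q') ≠ ((Sum.inl a, q) : DiagramPoint _ × DiagramPoint _) →
      pairDist (j α').1 q'.coords ≤ ENNReal.ofReal (D - c * t) := by
    intro α' q' hm hne
    refine (pairDist_triangle _ α'.1 _).trans ((add_le_add ((pairDist_comm _ _).trans_le
      (hjclose α')) (hother _ hm hne)).trans ?_)
    rw [← ENNReal.ofReal_add (by linarith) (by linarith)]
    exact ENNReal.ofReal_le_ofReal (by linarith)
  have hmain : bottleneckDist (VietorisRips.dgm F (cloudDist (Y + t • v)) k)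
      (VietorisRips.dgm F dX k) ≤ ENNReal.ofReal (D - c * t) := by
    refine bottleneckDist_le_of_injective hΩ hj ?_ ?_ ?_ ?_
    · intro α' β' hm
      by_cases h : (Sum.inl α', Sum.inl β') = ((Sum.inl a, q) : DiagramPoint _ × DiagramPoint _)
      · obtain ⟨h₁, h₂⟩ := Prod.mk.inj h
        rw [Sum.inl_injective h₁, hja]
        exact hr.1 β' h₂.symm
      · exact hmove α' _ hm h
    · intro α' x hm
      by_cases h : (Sum.inl α', Sum.inr x) = ((Sum.inl a, q) : DiagramPoint _ × DiagramPoint _)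
      · obtain ⟨h₁, h₂⟩ := Prod.mk.inj h
        rw [Sum.inl_injective h₁, hja]
        exact hr.2 x h₂.symm
      · exact ⟨x, hmove α' _ hm h⟩
    · intro x β' hm
      exact (hother _ hm (by simp)).trans (ENNReal.ofReal_le_ofReal (by linarith))
    · intro z hz
      obtain ⟨y, hy⟩ := hjrange z hz
      exact ⟨y, hy.trans (ENNReal.ofReal_le_ofReal (by linarith))⟩
  rw [hDeq]
  refine (add_le_add_left hmain _).trans_eq ?_
  rw [← ENNReal.ofReal_add (by linarith) hct0.le, sub_add_cancel]
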